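/- Let $E$ be a countable set and $R:E\times E\to\mathbb R$ a matrix of transition rates: $R(\eta,\xi)\ge 0$ for $\eta\ne\xi$, $-\infty<R(\eta,\eta)<0$ and $\sum_{\xi\in E}R(\eta,\xi)=0$ for all $\eta\in E$. Let $\lambda(\eta)=-R(\eta,\eta)$ be the holding rates, and let $p(\eta,\xi)=R(\eta,\xi)/\lambda(\eta)$ for $\eta\neq\xi$, $p(\eta,\eta)=0$, be the jump probabilities. Assume that the discrete time Markov chain with transition probabilities $p$ is irreducible and recurrent. Let $\{\eta(t):t\ge 0\}$ be the right-continuous (minimal) continuous time Markov process on $E$ with jump rates $R$, and write $\mathbf P_\eta$, $\mathbf E_\eta$ for its law and expectation when it starts from $\eta\in E$. Assume that the process is positive recurrent, let $\mu$ be its (unique) invariant probability measure, and assume that $\sum_{\eta\in E}\lambda(\eta)\mu(\eta)<\infty$. Put $M(\eta)=\lambda(\eta)\mu(\eta)$ and write $\langle f\rangle_\mu=\sum_{\eta\in E}f(\eta)\mu(\eta)$. For $A\subseteq E$ let $H_A^+=\inf\{t>0:\eta(t)\in A,\ \eta(s)\ne\eta(0)\text{ for some }0<s<t\}$ be the return time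 to $A$, and for disjoint $A,B\subseteq E$ let $$\mathrm{Cap}(A,B)=\sum_{\eta\in A}M(\eta)\,\mathbf P_\eta\big[H_B^+<H_A^+\big]$$ be the capacity between $A$ and $B$. Let $S$ be a finite set, let $\pi=\{A^x:x\in S\}$ be a partition of $E$, let $\xi_x\in A^x$ for each $x\in S$, and set $$\mathrm{Cap}(\xi_x)=\inf_{\eta\in A^x\setminus\{\xi_x\}}\mathrm{Cap}(\{\eta\},\{\xi_x\})\in[0,\infty],$$ with $\inf\varnothing=\infty$. For a $\mu$-integrable function $g:E\to\mathbb R$ let $$\langle g\,|\,\pi\rangle_\mu=\sum_{x\in S}\frac{\langle g\,\mathbf 1\{A^x\}\rangle_\mu}{\mu(A^x)}\,\mathbf 1\{A^x\}$$ be the conditional expectation of $g$ under $\mu$ given the $\sigma$-algebra generated by $\pi$. **Corollary.** For every $\mu$-integrable function $g:E\to\mathbb R$ and every $t>0$, the function $\{g-\langle g|\pi\rangle_\mu\}(\eta(s))$ is integrable with respect to $\mathbf P_\eta\otimes ds$ on $s\in(0,t]$ for every $\eta\in E$, and $$\sup_{\eta\in E}\Big|\mathbf E_\eta\Big[\int_0^t\big\{g-\langle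 g|\pi\rangle_\mu\big\}(\eta(s))\,ds\Big]\Big|\ \le\ 4\sum_{x\in S}\frac{\big\langle |g|\,\mathbf 1\{A^x\}\big\rangle_\mu}{\mathrm{Cap}(\xi_x)},$$ where both sides take values in $[0,\infty]$, with the conventions $a/\infty=0$ for $0\le a<\infty$, $a/0=\infty$ for $a>0$, and $0/0=0$. -/

import Mathlib

open MeasureTheory ProbabilityTheory
open scoped ENNReal

/-- A matrix of transition rates on `E`: nonnegative and finite off the diagonal, strictly negative
and finite on the diagonal, with vanishing row sums. -/
structure RateMatrix (E : Type*) where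
  /-- The entries `R(η, ξ)`. -/
  rate : E → E → ℝ
  nonneg_of_ne : ∀ η ξ, η ≠ ξ → 0 ≤ rate η ξ
  diag_neg : ∀ η, rate η η < 0
  hasSum_zero : ∀ η, HasSum (rate η) 0

namespace RateMatrix

noncomputable section

section Chain

variable {E : Type*} (R : RateMatrix E)

/-- The holding rates `λ(η) = -R(η, η)`. -/
def holdingRate (η : E) : ℝ := -R.rate η η

theorem holdingRate_pos (η : E) : 0 < R.holdingRate η := neg_pos.mpr (R.diag_neg η)

open Classical in
/-- The jump probabilities `p(η, ξ) = R(η, ξ) / λ(η)` for `η ≠ ξ`, and `p(η, η) = 0`. -/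
def jumpProb (η ξ : E) : ℝ := if ξ = η then 0 else R.rate η ξ / R.holdingRate η

theorem jumpProb_nonneg (η ξ : E) : 0 ≤ R.jumpProb η ξ := by
  unfold jumpProb
  split_ifs with h
  · exact le_rfl
  · exact div_nonneg (R.nonneg_of_ne η ξ (Ne.symm h)) (R.holdingRate_pos η).le

theorem hasSum_jumpProb (η : E) : HasSum (R.jumpProb η) 1 := by
  classical
  have h1 : HasSum (fun ξ => R.rate η ξ / R.holdingRate η) 0 := by
    simpa using (R.hasSum_zero η).div_const (R.holdingRate η)
  have h2 := h1.update η 0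
  have hne : R.holdingRate η ≠ 0 := (R.holdingRate_pos η).ne'
  have h3 : (0 : ℝ) - R.rate η η / R.holdingRate η + 0 = 1 := by
    have : R.rate η η = -R.holdingRate η := by simp [holdingRate]
    rw [this]
    field_simp
    ring
  have h4 : R.jumpProb η = Function.update (fun ξ => R.rate η ξ / R.holdingRate η) η 0 := by
    funext ξ
    simp [jumpProb, Function.update_apply]
  rw [h4, ← h3]
  convert h2 using 1

/-- The law `p(η, ·)` of the next state of the jump chain. -/
def jumpPMF (η : E) : PMF E :=
  ⟨fun ξ => ENNReal.ofReal (R.jumpProb η ξ), by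
    have h := ENNReal.ofReal_tsum_of_nonneg (R.jumpProb_nonneg η) (R.hasSum_jumpProb η).summable
    rw [(R.hasSum_jumpProb η).tsum_eq, ENNReal.ofReal_one] at h
    rw [h]
    exact ENNReal.summable.hasSum⟩

variable [Countable E] [MeasurableSpace E] [DiscreteMeasurableSpace E]

/-- The jump probabilities as a Markov kernel. -/
def jumpKernel : Kernel E E where
  toFun η := (R.jumpPMF η).toMeasure
  measurable' := .of_discrete

instance : IsMarkovKernel R.jumpKernel :=
  ⟨fun η => inferInstanceAs (IsProbabilityMeasure (R.jumpPMF η).toMeasure)⟩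

/-- The law, on the space of sequences of states, of the discrete time Markov chain
`Y = (Y_n)_{n ≥ 0}` with transition probabilities `p` started from `Y_0 = η`. -/
def chainLaw (η : E) : Measure (ℕ → E) :=
  Kernel.traj (X := fun _ => E)
    (fun n => R.jumpKernel.comap (fun y : (Finset.Iic n → E) => y ⟨n, Finset.mem_Iic.mpr le_rfl⟩)
      (measurable_pi_apply _)) 0 (fun _ => η)

instance (η : E) : IsProbabilityMeasure (R.chainLaw η) := by
  unfold chainLaw; infer_instance

/-- The jump chain is irreducible. -/
def IsIrreducible : Prop := ∀ η ξ, ∃ n, 0 < R.chainLaw η {y | y n = ξ}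

/-- The jump chain is recurrent: started from any state, it returns to it almost surely. -/
def IsRecurrent : Prop := ∀ η, ∀ᵐ y ∂(R.chainLaw η), ∃ n, 1 ≤ n ∧ y n = η

end Chain

instance : IsProbabilityMeasure (expMeasure 1) := isProbabilityMeasure_expMeasure one_pos

section JumpProcess

variable {E : Type*} (R : RateMatrix E)

/-- The sample space: a point consists of a sequence of states `(Y_n)` and of a sequence `(e_n)` of
real numbers, from which the trajectory of the continuous time process is built. -/
abbrev Sample (E : Type*) : Type _ := (ℕ → E) × (ℕ → ℝ)

/-- The law `P_η` of the process started from `η`: `Y` is the jump chain started from `η`, and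
`(e_n)` is an independent sequence of i.i.d. mean one exponential random variables. -/
def law [Countable E] [MeasurableSpace E] [DiscreteMeasurableSpace E] (η : E) :
    Measure (Sample E) :=
  (R.chainLaw η).prod (Measure.infinitePi fun _ : ℕ => expMeasure 1)

/-- The time `J_n = ∑_{k < n} e_k / λ(Y_k)` of the `n`-th jump. -/
def jumpTime (n : ℕ) (ω : Sample E) : ℝ :=
  ∑ k ∈ Finset.range n, ω.2 k / R.holdingRate (ω.1 k)

open Classical in
/-- The minimal right-continuous process with rates `R`: its value at time `t ≥ 0` is `Y_n` if
`J_n ≤ t < J_{n+1}`, and the cemetery state `none` if `t` is not smaller than the explosion time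
`sup_n J_n` (which is almost surely infinite if the jump chain is recurrent). -/
def path (t : ℝ) (ω : Sample E) : Option E :=
  if h : ∃ n, t < R.jumpTime (n + 1) ω then some (ω.1 (Nat.find h)) else none

/-- The return time `H_A⁺ = inf {t > 0 : η(t) ∈ A, η(s) ≠ η(0) for some 0 < s < t}`
(`∞` if there is no such `t`). -/
def returnTime (A : Set E) (ω : Sample E) : ℝ≥0∞ :=
  ⨅ (t : ℝ) (_ : 0 < t ∧ (∃ ζ ∈ A, R.path t ω = some ζ) ∧
    ∃ s, 0 < s ∧ s < t ∧ R.path s ω ≠ R.path 0 ω), ENNReal.ofReal t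

/-- The value of a function on `E` along the trajectory (zero at the cemetery state). -/
def evalPath (g : E → ℝ) (t : ℝ) (ω : Sample E) : ℝ := (R.path t ω).elim 0 g

variable [Countable E] [MeasurableSpace E] [DiscreteMeasurableSpace E]

/-- The process is positive recurrent: expected return times are finite. -/
def IsPositiveRecurrent : Prop := ∀ η, ∫⁻ ω, R.returnTime {η} ω ∂(R.law η) < ∞

/-- `μ` is invariant for the process: `∑_η μ(η) P_η[η(t) = ξ] = μ(ξ)` for all `t ≥ 0` and `ξ`. -/
def IsInvariant (μ : Measure E) : Prop :=
  ∀ t : ℝ, 0 ≤ t → ∀ ξ, ∑' η, μ {η} * R.law η {ω | R.path t ω = some ξ} = μ {ξ}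

/-- The capacity `Cap(A, B) = ∑_{η ∈ A} M(η) P_η[H_B⁺ < H_A⁺]` between two disjoint sets, where
`M(η) = λ(η) μ(η)`. -/
def capacity (μ : Measure E) (A B : Set E) : ℝ≥0∞ :=
  ∑' η : A, ENNReal.ofReal (R.holdingRate η) * μ {(η : E)} *
    R.law (η : E) {ω | R.returnTime B ω < R.returnTime A ω}

/-- The smallest capacity `inf_{η ∈ A \ {ξ}} Cap({η}, {ξ})` between `ξ` and another state of `A`
(`∞` if `A` contains no other state). -/
def pointCapacity (μ : Measure E) (A : Set E) (ξ : E) : ℝ≥0∞ :=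
  ⨅ η ∈ A \ {ξ}, R.capacity μ {η} {ξ}

end JumpProcess

end

end RateMatrix

/-- The conditional expectation `⟨g|π⟩_μ = ∑_x (⟨g 1_{A^x}⟩_μ / μ(A^x)) 1_{A^x}` of `g` given the
σ-algebra generated by a finite partition `π = {A^x}`. -/
noncomputable def partitionCondExp {E S : Type*} [MeasurableSpace E] [Fintype S]
    (μ : Measure E) (A : S → Set E) (g : E → ℝ) (η : E) : ℝ :=
  ∑ x, (A x).indicator (fun _ => (∫ ζ in A x, g ζ ∂μ) / μ.real (A x)) η

/-!
The function `h = g - ⟨g|π⟩` has `μ`-mean zero on every cell `A^x`, so `E_η ∫₀ᵗ h(η(s)) ds`, which is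
the sum of `h(ζ) G(ζ)` with `G(ζ)` the mean time spent at `ζ` until time `t`, is also the sum over
the cells of `h(ζ) μ(ζ) (G(ζ)/μ(ζ) - G(ξ_x)/μ(ξ_x))`. It therefore suffices to show that, for two
states `a ≠ b`, the quantities `G(a)/μ(a)` and `G(b)/μ(b)` differ by at most `1 / Cap({a}, {b})`
(`IsInvariant.abs_occupation_sub_mul_capacity_le`); the mass of `|h|` on a cell is at most twice that
of `|g|`, so that even the factor `2` in place of `4` is obtained.

For the estimate with two states, let `q` be a function with values in `[0, 1]` that vanishes at `a`,
equals `1` at `b` and is harmonic elsewhere; such a function is a least fixed point. By Dynkin's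
formula, `E_η q(η(t)) - q(η)`, which lies in `[-1, 1]`, is the integral of the generator applied to
`q` along the trajectory. This involves the times spent at `a` and at `b` only. The coefficients are
`λ(a) (pq)(a)` and `-λ(b) (1 - (pq)(b))`; since `M = λμ` is a finite invariant measure of the jump
chain, they become opposite when multiplied by `μ(a)` and `μ(b)`, and the first one dominates
`Cap({a}, {b}) / μ(a)` because `(pq)(a)` bounds the probability to reach `b` before the return to `a`
(`IsPotential.capacity_le`).

Dynkin's formula is obtained by integrating `q` against Kolmogorov's forward equation in integrated
form (`forward_equation`). That equation counts the visits to a state that begin before time `t`, and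
rests on the compensator identity for one exponential holding time (`lintegral_expMeasure_visit`)
and the Markov property of the jump chain. Integrated against `μ` it also gives the invariance of `M`
(`IsInvariant.tsum_chainWeight`). Explosion plays no role, as all these relations
hold for the minimal process.
-/

namespace RateMatrix

noncomputable section

/-! ### The jump chain -/

section Chain

variable {E : Type*} (R : RateMatrix E) [MeasurableSpace E] [DiscreteMeasurableSpace E]

/-- The Markov property at time `n`, for a functional `F` of the first `n + 1` states. -/
theorem lintegral_chainLaw_mul_succ (η : E) (n : ℕ) {F : (ℕ → E) → ℝ≥0∞} (hF : Measurable F)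
    (hdep : DependsOn F (Set.Iic n)) (ψ : E → ℝ≥0∞) :
    ∫⁻ y, F y * ψ (y (n + 1)) ∂(R.chainLaw η)
      = ∫⁻ y, F y * ∫⁻ b, ψ b ∂(R.jumpKernel (y n)) ∂(R.chainLaw η) := by
  -- `F` factors through the restriction to `{0, ..., n}`: freeze the sequence from time `n` on.
  let f : (Finset.Iic n → E) → ℝ≥0∞ := fun x =>
    F fun k => x ⟨min k n, Finset.mem_Iic.mpr (min_le_right k n)⟩
  have hf : Measurable f := hF.comp (measurable_pi_lambda _ fun _ => measurable_pi_apply _)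
  have hfF : ∀ y : ℕ → E, f (Preorder.frestrictLe n y) = F y := fun y =>
    hdep fun k hk => by simp [min_eq_left (Set.mem_Iic.mp hk)]
  have hψ : Measurable ψ := .of_discrete
  let κ : (n : ℕ) → Kernel (Finset.Iic n → E) E := fun n => R.jumpKernel.comap
    (fun y : (Finset.Iic n → E) => y ⟨n, Finset.mem_Iic.mpr le_rfl⟩) (measurable_pi_apply _)
  have key : (R.chainLaw η).map (fun y => (Preorder.frestrictLe (π := fun _ => E) n y, y (n + 1)))
      = (R.chainLaw η).map (Preorder.frestrictLe n) ⊗ₘ κ n := by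
    unfold chainLaw
    rw [Kernel.traj_map_frestrictLe_apply]
    exact (Kernel.partialTraj_compProd_eq_map_traj (X := fun _ => E) (κ := κ) (Nat.zero_le n)).symm
  have hk : Measurable fun a : E => ∫⁻ b, ψ b ∂(R.jumpKernel a) := .of_discrete
  calc ∫⁻ y, F y * ψ (y (n + 1)) ∂(R.chainLaw η)
      = ∫⁻ z : (Finset.Iic n → E) × E, f z.1 * ψ z.2
          ∂((R.chainLaw η).map fun y => (Preorder.frestrictLe n y, y (n + 1))) := by
        rw [lintegral_map (by fun_prop) (by fun_prop)]
        simp_rw [hfF]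
    _ = ∫⁻ x, f x * ∫⁻ b, ψ b ∂(R.jumpKernel (x ⟨n, Finset.mem_Iic.mpr le_rfl⟩))
          ∂((R.chainLaw η).map (Preorder.frestrictLe n)) := by
        rw [key, Measure.lintegral_compProd (by fun_prop)]
        refine lintegral_congr fun x => ?_
        exact lintegral_const_mul (μ := R.jumpKernel (x ⟨n, Finset.mem_Iic.mpr le_rfl⟩)) (f x) hψ
    _ = _ := by
        have hm : Measurable fun x : Finset.Iic n → E =>
            f x * ∫⁻ b, ψ b ∂(R.jumpKernel (x ⟨n, Finset.mem_Iic.mpr le_rfl⟩)) :=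
          hf.mul (hk.comp (measurable_pi_apply _))
        rw [lintegral_map hm (by fun_prop)]
        simp_rw [hfF]
        rfl

theorem chainLaw_zero [Countable E] (η : E) : ∀ᵐ y ∂(R.chainLaw η), y 0 = η := by
  have h := Kernel.traj_map_frestrictLe_apply (X := fun _ => E)
    (κ := fun n => R.jumpKernel.comap
      (fun y : (Finset.Iic n → E) => y ⟨n, Finset.mem_Iic.mpr le_rfl⟩) (measurable_pi_apply _))
    0 0 (fun _ => η)
  rw [Kernel.partialTraj_self, Kernel.id_apply] at h
  have h2 : ∀ᵐ x ∂((R.chainLaw η).map (Preorder.frestrictLe (π := fun _ => E) 0)),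
      x ⟨0, Finset.mem_Iic.mpr le_rfl⟩ = η := by
    unfold chainLaw
    rw [h]
    exact (ae_dirac_iff (measurableSet_eq_fun (measurable_pi_apply _) measurable_const)).mpr rfl
  exact ae_of_ae_map (by fun_prop) h2

open Classical in
theorem chainLaw_zero_apply [Countable E] (η ξ : E) :
    R.chainLaw η {y | y 0 = ξ} = if η = ξ then 1 else 0 := by
  have h := R.chainLaw_zero η
  have hm : MeasurableSet {y : ℕ → E | y 0 = ξ} :=
    measurableSet_eq_fun (measurable_pi_apply 0) measurable_const
  split_ifs with hηξ
  · rw [← prob_compl_eq_zero_iff hm, ← hηξ]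
    exact ae_iff.mp h
  · refine measure_mono_null (fun y hy => ?_) (ae_iff.mp h)
    intro h'
    exact hηξ (h'.symm.trans hy)

theorem jumpKernel_singleton_self (η : E) : R.jumpKernel η {η} = 0 := by
  change (R.jumpPMF η).toMeasure {η} = 0
  rw [PMF.toMeasure_apply_singleton _ _ (measurableSet_singleton η)]
  simp [jumpPMF, jumpProb, DFunLike.coe]

/-- Consecutive states of the jump chain are different, as `p(η, η) = 0`. -/
theorem chainLaw_one_ne [Countable E] (η : E) : ∀ᵐ y ∂(R.chainLaw η), y 1 ≠ y 0 := by
  classical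
  have h := R.lintegral_chainLaw_mul_succ η 0 (F := fun _ => 1) measurable_const
    (fun _ _ _ => rfl) (fun b => if b = η then 1 else 0)
  have hz : ∫⁻ y, 1 * ∫⁻ b, (if b = η then 1 else 0) ∂(R.jumpKernel (y 0)) ∂(R.chainLaw η) = 0 := by
    rw [lintegral_eq_zero_iff' (by
      exact ((Measurable.of_discrete (f := fun a : E =>
        ∫⁻ b, (if b = η then (1 : ℝ≥0∞) else 0) ∂(R.jumpKernel a))).comp
          (measurable_pi_apply 0)).const_mul 1 |>.aemeasurable)]
    filter_upwards [R.chainLaw_zero η] with y hy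
    have : (fun b : E => if b = η then (1 : ℝ≥0∞) else 0) = ({η} : Set E).indicator 1 := by
      ext b; simp [Set.indicator_apply]
    rw [this, hy, lintegral_indicator_one (measurableSet_singleton η), jumpKernel_singleton_self]
    simp
  rw [hz, lintegral_eq_zero_iff' (by
      exact ((Measurable.of_discrete (f := fun b : E => if b = η then (1 : ℝ≥0∞) else 0)).comp
          (measurable_pi_apply 1)).const_mul 1 |>.aemeasurable)] at h
  filter_upwards [h, R.chainLaw_zero η] with y hy hy0 hne
  rw [hy0] at hne
  simp [hne] at hy

/-- The Chapman-Kolmogorov equation for the last step. -/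
theorem chainLaw_succ [Countable E] (η ξ : E) (n : ℕ) :
    R.chainLaw η {y | y (n + 1) = ξ}
      = ∑' ζ, R.chainLaw η {y | y n = ζ} * R.jumpKernel ζ {ξ} := by
  have h := R.lintegral_chainLaw_mul_succ η n (F := fun _ => 1) measurable_const
    (fun _ _ _ => rfl) (({ξ} : Set E).indicator 1)
  have hm (k : ℕ) (ζ : E) : MeasurableSet {y : ℕ → E | y k = ζ} :=
    measurableSet_eq_fun (measurable_pi_apply k) measurable_const
  simp only [one_mul, lintegral_indicator_one (measurableSet_singleton ξ)] at h
  have h1 : (fun y : ℕ → E => ({ξ} : Set E).indicator (1 : E → ℝ≥0∞) (y (n + 1)))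
      = {y : ℕ → E | y (n + 1) = ξ}.indicator 1 := rfl
  rw [h1, lintegral_indicator_one (hm _ _)] at h
  rw [h, ← lintegral_map (f := fun a => R.jumpKernel a {ξ}) (g := fun y : ℕ → E => y n)
    .of_discrete (measurable_pi_apply n), lintegral_countable']
  refine tsum_congr fun ζ => ?_
  rw [Measure.map_apply (measurable_pi_apply n) (measurableSet_singleton ζ), mul_comm]
  rfl

end Chain

/-! ### Exponential holding times -/

theorem expMeasure_one_Iic {x : ℝ} (hx : 0 ≤ x) :
    expMeasure 1 (Set.Iic x) = ENNReal.ofReal (1 - Real.exp (-x)) := by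
  rw [← ofReal_cdf, cdf_expMeasure_eq one_pos, if_pos hx, one_mul]

theorem expMeasure_one_Ioi {x : ℝ} (hx : 0 ≤ x) :
    expMeasure 1 (Set.Ioi x) = ENNReal.ofReal (Real.exp (-x)) := by
  rw [← Set.compl_Iic, prob_compl_eq_one_sub measurableSet_Iic, expMeasure_one_Iic hx,
    ← ENNReal.ofReal_one, ← ENNReal.ofReal_sub _ (by simpa using hx)]
  congr 1; ring

theorem expMeasure_one_pos : ∀ᵐ x ∂(expMeasure 1), 0 < x := by
  have h : expMeasure 1 (Set.Iic 0) = 0 := by simp [expMeasure_one_Iic le_rfl]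
  rw [ae_iff]
  simpa [Set.Iic] using h

/-- The compensator identity for one holding time: for a visit that starts at time `a` and ends at
time `a + x / l`, where `x` is exponential, `l` times the mean duration of the part of the visit
before time `t` is the probability that the visit ends before time `t`. -/
theorem lintegral_expMeasure_visit {l a : ℝ} (hl : 0 < l) (ha : 0 ≤ a) (t : ℝ) :
    ENNReal.ofReal l * ∫⁻ s in Set.Ioc 0 t, expMeasure 1 {x | a ≤ s ∧ s < a + x / l}
      = expMeasure 1 {x | a + x / l ≤ t} := by
  have hset : {x : ℝ | a + x / l ≤ t} = Set.Iic (l * (t - a)) := by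
    ext x
    simp only [Set.mem_ofPred_eq, Set.mem_Iic]
    rw [← le_sub_iff_add_le', div_le_iff₀' hl]
  have hvis (s : ℝ) : expMeasure 1 {x | a ≤ s ∧ s < a + x / l}
      = (Set.Ici a).indicator (fun s => ENNReal.ofReal (Real.exp (-(l * (s - a))))) s := by
    by_cases has : a ≤ s
    · rw [Set.indicator_of_mem (Set.mem_Ici.mpr has),
        ← expMeasure_one_Ioi (mul_nonneg hl.le (sub_nonneg.mpr has))]
      congr 1
      ext x
      simp only [Set.mem_ofPred_eq, Set.mem_Ioi, has, true_and]
      rw [← sub_lt_iff_lt_add', lt_div_iff₀' hl]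
    · simp [has]
  simp_rw [hvis]
  rw [hset, setLIntegral_indicator measurableSet_Ici]
  rcases lt_or_ge t a with hta | hta
  · have h1 : Set.Ici a ∩ Set.Ioc 0 t = ∅ := by
      ext s; simp only [Set.mem_inter_iff, Set.mem_Ici, Set.mem_Ioc, Set.mem_empty_iff_false,
        iff_false, not_and]
      intro h _ h'; linarith
    have h2 : expMeasure 1 (Set.Iic (l * (t - a))) = 0 := by
      refine measure_mono_null (Set.Iic_subset_Iic.mpr ?_)
        (by simp [expMeasure_one_Iic le_rfl] : expMeasure 1 (Set.Iic 0) = 0)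
      exact mul_nonpos_of_nonneg_of_nonpos hl.le (by linarith)
    rw [h1, h2]; simp
  · have h1 : (Set.Ici a ∩ Set.Ioc 0 t : Set ℝ) =ᵐ[volume] Set.Ioc a t := by
      rcases ha.eq_or_lt with rfl | ha
      · have : Set.Ici (0 : ℝ) ∩ Set.Ioc 0 t = Set.Ioc 0 t :=
          Set.inter_eq_right.mpr fun s hs => hs.1.le
        rw [this]
        exact ae_eq_refl _
      · have : Set.Ici a ∩ Set.Ioc 0 t = Set.Icc a t := by
          ext s; simp only [Set.mem_inter_iff, Set.mem_Ici, Set.mem_Ioc, Set.mem_Icc]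
          exact ⟨fun h => ⟨h.1, h.2.2⟩, fun h => ⟨h.1, ha.trans_le h.1, h.2⟩⟩
        rw [this]
        exact Ioc_ae_eq_Icc.symm
    rw [setLIntegral_congr h1, ← lintegral_const_mul _ (by fun_prop),
      expMeasure_one_Iic (mul_nonneg hl.le (sub_nonneg.mpr hta))]
    simp_rw [← ENNReal.ofReal_mul hl.le]
    have hc : Continuous fun s : ℝ => l * Real.exp (-(l * (s - a))) := by fun_prop
    rw [← ofReal_integral_eq_lintegral_ofReal
      (hc.integrableOn_Ioc) (ae_of_all _ fun s => by positivity),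
      ← intervalIntegral.integral_of_le hta,
      intervalIntegral.integral_eq_sub_of_hasDerivAt
        (f := fun s => -Real.exp (-(l * (s - a)))) _ (hc.intervalIntegrable _ _)]
    · congr 1
      simp; ring
    · intro s _
      have h := (((((hasDerivAt_id' s).sub_const a).const_mul l).fun_neg).exp).fun_neg
      exact h.congr_deriv (by ring)

/-! ### Jump times and trajectories -/

/-- The law of the sequence `(e_n)` of i.i.d. mean one exponential random variables. -/
abbrev waitingLaw : Measure (ℕ → ℝ) := Measure.infinitePi fun _ : ℕ => expMeasure 1

theorem waitingLaw_pos : ∀ᵐ e ∂waitingLaw, ∀ k, 0 < e k := by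
  refine ae_all_iff.mpr fun k => ?_
  have h := expMeasure_one_pos
  rw [← Measure.infinitePi_map_eval (fun _ : ℕ => expMeasure 1) k] at h
  exact ae_of_ae_map (measurable_pi_apply k).aemeasurable h

theorem measurableSet_le_and_lt {α : Type*} [MeasurableSpace α] {f g h : α → ℝ}
    (hf : Measurable f) (hg : Measurable g) (hh : Measurable h) :
    MeasurableSet {a | f a ≤ g a ∧ g a < h a} :=
  (measurableSet_le hf hg).inter (measurableSet_lt hg hh)

section Path

variable {E : Type*} (R : RateMatrix E)

theorem jumpTime_zero (ω : Sample E) : R.jumpTime 0 ω = 0 := by simp [jumpTime]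

theorem jumpTime_succ (n : ℕ) (ω : Sample E) :
    R.jumpTime (n + 1) ω = R.jumpTime n ω + ω.2 n / R.holdingRate (ω.1 n) := by
  simp [jumpTime, Finset.sum_range_succ]

theorem jumpTime_strictMono {ω : Sample E} (h : ∀ k, 0 < ω.2 k) :
    StrictMono fun n => R.jumpTime n ω :=
  strictMono_nat_of_lt_succ fun n => by
    rw [jumpTime_succ]
    exact lt_add_of_pos_right _ (div_pos (h n) (R.holdingRate_pos _))

theorem jumpTime_nonneg {ω : Sample E} (h : ∀ k, 0 < ω.2 k) (n : ℕ) : 0 ≤ R.jumpTime n ω := by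
  have := (R.jumpTime_strictMono h).monotone (Nat.zero_le n)
  simpa [jumpTime_zero] using this

theorem path_eq_some_iff_find (s : ℝ) (ω : Sample E) (ζ : E) :
    R.path s ω = some ζ ↔
      ∃ n, ω.1 n = ζ ∧ s < R.jumpTime (n + 1) ω ∧ ∀ m < n, ¬ s < R.jumpTime (m + 1) ω := by
  classical
  unfold path
  split_ifs with h
  · rw [Option.some_inj]
    constructor
    · rintro rfl
      exact ⟨_, rfl, (Nat.find_spec h), fun m hm => Nat.find_min h hm⟩
    · rintro ⟨n, rfl, hn, hmin⟩
      rw [(Nat.find_eq_iff h).mpr ⟨hn, hmin⟩]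
  · simp only [false_iff]
    rintro ⟨n, -, hn, -⟩
    exact h ⟨n, hn⟩

/-- The event that the `n`-th visit of the trajectory is to `ζ` and takes place at time `s`. -/
def visit (n : ℕ) (ζ : E) (s : ℝ) : Set (Sample E) :=
  {ω | ω.1 n = ζ ∧ R.jumpTime n ω ≤ s ∧ s < R.jumpTime (n + 1) ω}

theorem path_eq_some_iff {s : ℝ} (hs : 0 ≤ s) {ω : Sample E} (h : ∀ k, 0 < ω.2 k) (ζ : E) :
    R.path s ω = some ζ ↔ ∃ n, ω ∈ R.visit n ζ s := by
  rw [path_eq_some_iff_find]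
  refine exists_congr fun n => and_congr_right fun _ => ?_
  rw [and_comm]
  refine and_congr_left fun _ => ?_
  constructor
  · intro hm
    cases n with
    | zero => simpa [jumpTime_zero] using hs
    | succ n => exact not_lt.mp (hm n (Nat.lt_succ_self n))
  · intro hn m hm
    exact not_lt.mpr (((R.jumpTime_strictMono h).monotone hm).trans hn)

theorem visit_unique {ω : Sample E} (h : ∀ k, 0 < ω.2 k) {s : ℝ} {m n : ℕ} {ζ ζ' : E}
    (hm : ω ∈ R.visit m ζ s) (hn : ω ∈ R.visit n ζ' s) : m = n := by
  have hmono := R.jumpTime_strictMono h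
  have h1 := hmono.lt_iff_lt.mp (hm.2.1.trans_lt hn.2.2)
  have h2 := hmono.lt_iff_lt.mp (hn.2.1.trans_lt hm.2.2)
  omega

/-- As `Y_1 ≠ Y_0`, the trajectory has left its starting point when it reaches `Y_k`, `k ≥ 2`, so
that this visit counts as a return. -/
theorem returnTime_le_jumpTime {ω : Sample E} (hpos : ∀ k, 0 < ω.2 k) (h1 : ω.1 1 ≠ ω.1 0) {k : ℕ}
    (hk : 2 ≤ k) : R.returnTime {ω.1 k} ω ≤ ENNReal.ofReal (R.jumpTime k ω) := by
  have hmono := R.jumpTime_strictMono hpos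
  have hpath (n : ℕ) : R.path (R.jumpTime n ω) ω = some (ω.1 n) :=
    (R.path_eq_some_iff (R.jumpTime_nonneg hpos n) hpos _).mpr
      ⟨n, rfl, le_rfl, hmono (Nat.lt_succ_self n)⟩
  have h0 : R.path 0 ω = some (ω.1 0) := by simpa [jumpTime_zero] using hpath 0
  have hJ1 : 0 < R.jumpTime 1 ω := by simpa [jumpTime_zero] using hmono zero_lt_one
  have hJk : R.jumpTime 1 ω < R.jumpTime k ω := hmono hk
  refine iInf₂_le (R.jumpTime k ω) ⟨hJ1.trans hJk, ⟨_, rfl, hpath k⟩, R.jumpTime 1 ω, hJ1, hJk, ?_⟩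
  rw [hpath 1, h0]
  exact fun h => h1 (Option.some_injective _ h)

variable [MeasurableSpace E] [DiscreteMeasurableSpace E]

@[fun_prop]
theorem measurable_jumpTime (n : ℕ) : Measurable (R.jumpTime n) := by
  unfold jumpTime
  refine Finset.measurable_sum _ fun k _ => Measurable.div (by fun_prop) ?_
  exact (Measurable.of_discrete (f := R.holdingRate)).comp (by fun_prop)

variable [Countable E]

theorem measurableSet_state (n : ℕ) (ζ : E) : MeasurableSet {ω : Sample E | ω.1 n = ζ} :=
  measurableSet_eq_fun (by fun_prop) measurable_const

theorem measurableSet_visit_prod (n : ℕ) (ζ : E) :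
    MeasurableSet {z : Sample E × ℝ | z.1 ∈ R.visit n ζ z.2} := by
  have h : MeasurableSet {z : Sample E × ℝ |
      R.jumpTime n z.1 ≤ z.2 ∧ z.2 < R.jumpTime (n + 1) z.1} :=
    measurableSet_le_and_lt (by fun_prop) measurable_snd (by fun_prop)
  exact ((measurableSet_state n ζ).preimage measurable_fst).inter h

theorem measurableSet_visit (n : ℕ) (ζ : E) (s : ℝ) : MeasurableSet (R.visit n ζ s) :=
  (R.measurableSet_visit_prod n ζ).preimage measurable_prodMk_right

/-- The trajectory is jointly measurable in the sample point and in time. -/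
theorem measurableSet_path_prod (ζ : E) :
    MeasurableSet {z : Sample E × ℝ | R.path z.2 z.1 = some ζ} := by
  simp_rw [path_eq_some_iff_find, not_lt]
  refine measurableSet_setOfPred.mpr (Measurable.exists fun n => ?_)
  refine Measurable.and ?_ (Measurable.and ?_ ?_)
  · exact measurableSet_setOfPred.mp ((measurableSet_state n ζ).preimage measurable_fst)
  · exact measurableSet_setOfPred.mp (measurableSet_lt (by fun_prop) (by fun_prop))
  · refine Measurable.forall fun m => Measurable.imp measurable_const ?_
    exact measurableSet_setOfPred.mp (measurableSet_le (by fun_prop) (by fun_prop))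

instance (η : E) : IsProbabilityMeasure (R.law η) := by
  unfold law; infer_instance

theorem law_pos (η : E) : ∀ᵐ ω ∂(R.law η), ∀ k, 0 < ω.2 k :=
  Measure.quasiMeasurePreserving_snd.ae waitingLaw_pos

theorem law_fst_preimage (η : E) (T : Set (ℕ → E)) :
    R.law η (Prod.fst ⁻¹' T) = R.chainLaw η T := by
  unfold law
  rw [← Set.prod_univ, Measure.prod_prod, measure_univ, mul_one]

theorem law_chain_ae {η : E} {P : (ℕ → E) → Prop} (h : ∀ᵐ y ∂(R.chainLaw η), P y) :
    ∀ᵐ ω ∂(R.law η), P ω.1 :=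
  Measure.quasiMeasurePreserving_fst.ae h

theorem law_state_inter (η : E) (n : ℕ) (ζ : E) {T : Set (Sample E)} (hT : MeasurableSet T) :
    R.law η {ω | ω.1 n = ζ ∧ ω ∈ T}
      = ∫⁻ y, {y : ℕ → E | y n = ζ}.indicator (fun y => waitingLaw {e | (y, e) ∈ T}) y
          ∂(R.chainLaw η) := by
  have hm : MeasurableSet {ω : Sample E | ω.1 n = ζ ∧ ω ∈ T} := (measurableSet_state n ζ).inter hT
  unfold law
  rw [Measure.prod_apply hm]
  refine lintegral_congr fun y => ?_
  by_cases hy : y n = ζ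
  · simp [Set.preimage, hy]
  · simp [Set.preimage, hy]

end Path

/-! ### The forward equation -/

section Forward

variable {E : Type*} (R : RateMatrix E) [MeasurableSpace E] [DiscreteMeasurableSpace E]

/-- The compensator identity for the `n`-th visit, given the sequence of states. -/
theorem lintegral_waitingLaw_visit (y : ℕ → E) (n : ℕ) (t : ℝ) :
    ENNReal.ofReal (R.holdingRate (y n)) * ∫⁻ s in Set.Ioc 0 t,
        waitingLaw {e | R.jumpTime n (y, e) ≤ s ∧ s < R.jumpTime (n + 1) (y, e)}
      = waitingLaw {e | R.jumpTime (n + 1) (y, e) ≤ t} := by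
  set l := R.holdingRate (y n)
  have hl : 0 < l := R.holdingRate_pos _
  have hJ : Measurable fun e : ℕ → ℝ => R.jumpTime n (y, e) := by fun_prop
  -- the `n`-th jump time and the `n`-th waiting time are independent
  have hind : IndepFun (fun e : ℕ → ℝ => R.jumpTime n (y, e)) (fun e => e n) waitingLaw := by
    have h1 : iIndepFun (fun i (e : ℕ → ℝ) => e i / R.holdingRate (y i)) waitingLaw :=
      iIndepFun_infinitePi (P := fun _ : ℕ => expMeasure 1)
        (X := fun i x => x / R.holdingRate (y i)) fun i => by fun_prop
    have h2 := h1.indepFun_finsetSum_of_notMem (fun i => by fun_prop)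
      (Finset.notMem_range_self (n := n))
    have h3 := h2.comp measurable_id (measurable_mul_const l)
    convert h3 using 1
    · ext e; simp [jumpTime]
    · ext e; simp [l, div_mul_cancel₀ _ hl.ne']
  have hmap : waitingLaw.map (fun e : ℕ → ℝ => (R.jumpTime n (y, e), e n))
      = (waitingLaw.map fun e => R.jumpTime n (y, e)).prod (expMeasure 1) := by
    rw [hind.map_prod_eq_prod_map_map hJ.aemeasurable (measurable_pi_apply n).aemeasurable]
    congr 1
    exact Measure.infinitePi_map_eval (fun _ : ℕ => expMeasure 1) n
  have hprob : IsProbabilityMeasure (waitingLaw.map fun e : ℕ → ℝ => R.jumpTime n (y, e)) :=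
    Measure.isProbabilityMeasure_map hJ.aemeasurable
  have hdis {C : Set (ℝ × ℝ)} (hC : MeasurableSet C) :
      waitingLaw {e | (R.jumpTime n (y, e), e n) ∈ C}
        = ∫⁻ a, expMeasure 1 {x | (a, x) ∈ C}
            ∂(waitingLaw.map fun e => R.jumpTime n (y, e)) := by
    have h := Measure.prod_apply (μ := waitingLaw.map fun e => R.jumpTime n (y, e))
      (ν := expMeasure 1) hC
    rw [← hmap, Measure.map_apply (hJ.prodMk (measurable_pi_apply n)) hC] at h
    exact h
  have hnn : ∀ᵐ a ∂(waitingLaw.map fun e => R.jumpTime n (y, e)), 0 ≤ a := by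
    rw [ae_map_iff hJ.aemeasurable measurableSet_Ici]
    filter_upwards [waitingLaw_pos] with e he using R.jumpTime_nonneg (ω := (y, e)) he n
  have hV : MeasurableSet {z : (ℝ × ℝ) × ℝ | z.1.1 ≤ z.2 ∧ z.2 < z.1.1 + z.1.2 / l} :=
    measurableSet_le_and_lt (by fun_prop) (by fun_prop) (by fun_prop)
  have hD : MeasurableSet {z : ℝ × ℝ | z.1 + z.2 / l ≤ t} :=
    measurableSet_le (by fun_prop) (by fun_prop)
  have hsucc (e : ℕ → ℝ) : R.jumpTime (n + 1) (y, e) = R.jumpTime n (y, e) + e n / l :=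
    R.jumpTime_succ n (y, e)
  simp_rw [hsucc]
  calc _ = ENNReal.ofReal l * ∫⁻ s in Set.Ioc 0 t,
        ∫⁻ a, expMeasure 1 {x | a ≤ s ∧ s < a + x / l}
          ∂(waitingLaw.map fun e => R.jumpTime n (y, e)) := by
        congr 1
        refine lintegral_congr fun s => ?_
        exact hdis (hV.preimage measurable_prodMk_right)
    _ = ∫⁻ a, (ENNReal.ofReal l * ∫⁻ s in Set.Ioc 0 t,
          expMeasure 1 {x | a ≤ s ∧ s < a + x / l})
          ∂(waitingLaw.map fun e => R.jumpTime n (y, e)) := by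
        have hm : Measurable fun p : ℝ × ℝ => expMeasure 1 {x | p.1 ≤ p.2 ∧ p.2 < p.1 + x / l} :=
          measurable_measure_prodMk_left (ν := expMeasure 1)
            (s := {z : (ℝ × ℝ) × ℝ | z.1.1 ≤ z.1.2 ∧ z.1.2 < z.1.1 + z.2 / l})
            (hV.preimage (f := fun z : (ℝ × ℝ) × ℝ => ((z.1.1, z.2), z.1.2)) (by fun_prop))
        rw [lintegral_lintegral_swap (by exact (hm.comp measurable_swap).aemeasurable),
          ← lintegral_const_mul _ (by exact hm.lintegral_prod_right')]
    _ = ∫⁻ a, expMeasure 1 {x | a + x / l ≤ t}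
          ∂(waitingLaw.map fun e => R.jumpTime n (y, e)) := by
        refine lintegral_congr_ae ?_
        filter_upwards [hnn] with a ha using lintegral_expMeasure_visit hl ha t
    _ = _ := (hdis hD).symm

variable [Countable E]

theorem measurable_law_visit (η : E) (n : ℕ) (ζ : E) :
    Measurable fun s => R.law η (R.visit n ζ s) :=
  measurable_measure_prodMk_right (R.measurableSet_visit_prod n ζ)

/-- The compensator identity for the `n`-th visit. -/
theorem holdingRate_mul_lintegral_law_visit (η : E) (n : ℕ) (ζ : E) (t : ℝ) :
    ENNReal.ofReal (R.holdingRate ζ) * ∫⁻ s in Set.Ioc 0 t, R.law η (R.visit n ζ s)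
      = R.law η {ω | ω.1 n = ζ ∧ R.jumpTime (n + 1) ω ≤ t} := by
  have hT (s : ℝ) : MeasurableSet
      {ω : Sample E | R.jumpTime n ω ≤ s ∧ s < R.jumpTime (n + 1) ω} :=
    measurableSet_le_and_lt (by fun_prop) measurable_const (by fun_prop)
  have hU : MeasurableSet {ω : Sample E | R.jumpTime (n + 1) ω ≤ t} :=
    measurableSet_le (by fun_prop) measurable_const
  have hjoint : Measurable fun p : ℝ × (ℕ → E) => waitingLaw
      {e | R.jumpTime n (p.2, e) ≤ p.1 ∧ p.1 < R.jumpTime (n + 1) (p.2, e)} := by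
    have h1 : MeasurableSet {z : (ℝ × (ℕ → E)) × (ℕ → ℝ) |
        R.jumpTime n (z.1.2, z.2) ≤ z.1.1 ∧ z.1.1 < R.jumpTime (n + 1) (z.1.2, z.2)} :=
      measurableSet_le_and_lt (by fun_prop) (by fun_prop) (by fun_prop)
    exact measurable_measure_prodMk_left h1
  have hS : MeasurableSet {y : ℕ → E | y n = ζ} :=
    measurableSet_eq_fun (measurable_pi_apply n) measurable_const
  have h1 (s : ℝ) := R.law_state_inter η n ζ (hT s)
  have h2 := R.law_state_inter η n ζ hU
  change _ = R.law η {ω | ω.1 n = ζ ∧ ω ∈ {ω : Sample E | R.jumpTime (n + 1) ω ≤ t}}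
  rw [h2]
  change ENNReal.ofReal (R.holdingRate ζ) * ∫⁻ s in Set.Ioc 0 t, R.law η {ω | ω.1 n = ζ ∧ ω ∈
    {ω : Sample E | R.jumpTime n ω ≤ s ∧ s < R.jumpTime (n + 1) ω}} = _
  simp_rw [h1]
  have hm : Measurable fun p : ℝ × (ℕ → E) => {y : ℕ → E | y n = ζ}.indicator (fun y => waitingLaw
      {e | R.jumpTime n (y, e) ≤ p.1 ∧ p.1 < R.jumpTime (n + 1) (y, e)}) p.2 :=
    hjoint.indicator (hS.preimage measurable_snd)
  have hswap := lintegral_lintegral_swap (μ := volume.restrict (Set.Ioc 0 t)) (ν := R.chainLaw η)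
    (f := fun s y => {y : ℕ → E | y n = ζ}.indicator (fun y => waitingLaw
      {e | R.jumpTime n (y, e) ≤ s ∧ s < R.jumpTime (n + 1) (y, e)}) y) hm.aemeasurable
  refine (congrArg _ hswap).trans ?_
  rw [← lintegral_const_mul _ (by exact hm.lintegral_prod_left')]
  refine lintegral_congr fun y => ?_
  by_cases hy : y n = ζ
  · simp only [Set.indicator_of_mem (show y ∈ {y : ℕ → E | y n = ζ} from hy)]
    rw [← hy]
    exact R.lintegral_waitingLaw_visit y n t
  · simp [hy]

/-- The mean time spent at `ζ` until time `t` by the process started from `η`. -/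
def occupation (t : ℝ) (η ζ : E) : ℝ≥0∞ :=
  ∫⁻ s in Set.Ioc 0 t, R.law η {ω | R.path s ω = some ζ}

theorem law_path_eq_tsum (η ζ : E) {s : ℝ} (hs : 0 ≤ s) :
    R.law η {ω | R.path s ω = some ζ} = ∑' n, R.law η (R.visit n ζ s) := by
  have h1 : R.law η {ω | R.path s ω = some ζ} = R.law η (⋃ n, R.visit n ζ s) := by
    refine measure_congr ?_
    filter_upwards [R.law_pos η] with ω hω
    refine propext ?_
    exact (R.path_eq_some_iff hs hω ζ).trans Set.mem_iUnion.symm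
  rw [h1, measure_iUnion₀ ?_ fun n => (R.measurableSet_visit n ζ s).nullMeasurableSet]
  intro m n hmn
  refine measure_mono_null (t := {ω | ¬ ∀ k, 0 < ω.2 k}) ?_ (ae_iff.mp (R.law_pos η))
  intro ω hω hpos
  exact hmn (R.visit_unique hpos hω.1 hω.2)

/-- The mean number of jumps out of `ζ` until time `t` is `λ(ζ)` times the mean time spent there. -/
theorem holdingRate_mul_occupation (t : ℝ) (η ζ : E) :
    ENNReal.ofReal (R.holdingRate ζ) * R.occupation t η ζ
      = ∑' n, R.law η {ω | ω.1 n = ζ ∧ R.jumpTime (n + 1) ω ≤ t} := by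
  have h : R.occupation t η ζ = ∑' n, ∫⁻ s in Set.Ioc 0 t, R.law η (R.visit n ζ s) := by
    unfold occupation
    rw [setLIntegral_congr_fun measurableSet_Ioc
      (fun s hs => R.law_path_eq_tsum η ζ (le_of_lt hs.1)),
      lintegral_tsum fun n => (R.measurable_law_visit η n ζ).aemeasurable]
  rw [h, ← ENNReal.tsum_mul_left]
  exact tsum_congr fun n => R.holdingRate_mul_lintegral_law_visit η n ζ t

/-- Given the chain up to its `n`-th state and all waiting times, so in particular given the time
`J_{n+1}` of the next jump, the target of that jump is drawn from `p(Y_n, ·)`. -/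
theorem law_jump (t : ℝ) (η ξ : E) (n : ℕ) :
    R.law η {ω | ω.1 (n + 1) = ξ ∧ R.jumpTime (n + 1) ω ≤ t}
      = ∑' ζ, R.law η {ω | ω.1 n = ζ ∧ R.jumpTime (n + 1) ω ≤ t} * R.jumpKernel ζ {ξ} := by
  have hU : MeasurableSet {ω : Sample E | R.jumpTime (n + 1) ω ≤ t} :=
    measurableSet_le (by fun_prop) measurable_const
  let F : (ℕ → E) → ℝ≥0∞ := fun y => waitingLaw {e | R.jumpTime (n + 1) (y, e) ≤ t}
  have hF : Measurable F := measurable_measure_prodMk_left hU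
  have hdep : DependsOn F (Set.Iic n) := by
    intro y y' h
    have (e : ℕ → ℝ) : R.jumpTime (n + 1) (y, e) = R.jumpTime (n + 1) (y', e) := by
      unfold jumpTime
      refine Finset.sum_congr rfl fun k hk => ?_
      have hk' : k ∈ Set.Iic n := Nat.lt_succ_iff.mp (Finset.mem_range.mp hk)
      simp [h k hk']
    simp [F, this]
  have hl (m : ℕ) (ζ : E) := R.law_state_inter η m ζ hU
  have hS (m : ℕ) (ζ : E) : MeasurableSet {y : ℕ → E | y m = ζ} :=
    measurableSet_eq_fun (measurable_pi_apply m) measurable_const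
  calc _ = ∫⁻ y, F y * ({ξ} : Set E).indicator 1 (y (n + 1)) ∂(R.chainLaw η) := by
        refine (hl (n + 1) ξ).trans (lintegral_congr fun y => ?_)
        by_cases hy : y (n + 1) = ξ <;> simp [hy, F]
    _ = ∫⁻ y, F y * R.jumpKernel (y n) {ξ} ∂(R.chainLaw η) := by
        rw [R.lintegral_chainLaw_mul_succ η n hF hdep]
        simp_rw [lintegral_indicator_one (measurableSet_singleton ξ)]
    _ = ∫⁻ y, ∑' ζ, {y : ℕ → E | y n = ζ}.indicator F y * R.jumpKernel ζ {ξ}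
          ∂(R.chainLaw η) := by
        refine lintegral_congr fun y => ?_
        rw [tsum_eq_single (y n)]
        · simp
        · intro ζ hζ
          simp [hζ.symm]
    _ = _ := by
        rw [lintegral_tsum fun ζ => ((hF.indicator (hS n ζ)).mul_const _).aemeasurable]
        refine tsum_congr fun ζ => ?_
        rw [lintegral_mul_const _ (hF.indicator (hS n ζ))]
        exact congrArg (· * _) (hl n ζ).symm

open Classical in
/-- Kolmogorov's forward equation, in integrated form. Both sides are the expected number of visits
to `ξ` that begin at or before time `t`: on the left they are counted by the jump that starts them,
on the right according to whether they are over at time `t`. -/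
theorem forward_equation (η ξ : E) {t : ℝ} (ht : 0 ≤ t) :
    (if η = ξ then 1 else 0)
        + ∑' ζ, ENNReal.ofReal (R.holdingRate ζ) * R.occupation t η ζ * R.jumpKernel ζ {ξ}
      = R.law η {ω | R.path t ω = some ξ}
        + ENNReal.ofReal (R.holdingRate ξ) * R.occupation t η ξ := by
  have hU (n : ℕ) : MeasurableSet {ω : Sample E | R.jumpTime n ω ≤ t} :=
    measurableSet_le (by fun_prop) measurable_const
  have hsplit (n : ℕ) : R.law η {ω | ω.1 n = ξ ∧ R.jumpTime n ω ≤ t}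
      = R.law η (R.visit n ξ t) + R.law η {ω | ω.1 n = ξ ∧ R.jumpTime (n + 1) ω ≤ t} := by
    rw [← measure_inter_add_sdiff {ω | ω.1 n = ξ ∧ R.jumpTime n ω ≤ t} (hU (n + 1)), add_comm]
    congr 1
    · congr 1
      ext ω
      simp [visit, and_assoc]
    · refine measure_congr ?_
      filter_upwards [R.law_pos η] with ω hω
      refine propext ⟨fun h => ⟨h.1.1, h.2⟩, fun h => ⟨⟨h.1, ?_⟩, h.2⟩⟩
      exact ((R.jumpTime_strictMono hω).monotone (Nat.le_succ n)).trans h.2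
  have hzero : R.law η {ω | ω.1 0 = ξ ∧ R.jumpTime 0 ω ≤ t} = if η = ξ then 1 else 0 := by
    simp only [jumpTime_zero, ht, and_true]
    exact (R.law_fst_preimage η {y | y 0 = ξ}).trans (R.chainLaw_zero_apply η ξ)
  calc _ = ∑' n, R.law η {ω | ω.1 n = ξ ∧ R.jumpTime n ω ≤ t} := by
        rw [tsum_eq_zero_add' ENNReal.summable, hzero]
        simp_rw [R.holdingRate_mul_occupation, R.law_jump, ← ENNReal.tsum_mul_right]
        rw [ENNReal.tsum_comm]
    _ = _ := by
        simp_rw [hsplit]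
        rw [ENNReal.tsum_add, R.holdingRate_mul_occupation, R.law_path_eq_tsum η ξ ht]

end Forward

/-! ### The invariant measure of the jump chain -/

section Invariant

variable {E : Type*} (R : RateMatrix E) [MeasurableSpace E] [DiscreteMeasurableSpace E]
  [Countable E]

theorem measurable_law_path (η ζ : E) : Measurable fun s => R.law η {ω | R.path s ω = some ζ} :=
  measurable_measure_prodMk_right (R.measurableSet_path_prod ζ)

theorem measurableSet_path (s : ℝ) (ζ : E) : MeasurableSet {ω : Sample E | R.path s ω = some ζ} :=
  (R.measurableSet_path_prod ζ).preimage measurable_prodMk_right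

theorem occupation_le (t : ℝ) (η ζ : E) : R.occupation t η ζ ≤ ENNReal.ofReal t := by
  calc R.occupation t η ζ ≤ ∫⁻ _ in Set.Ioc 0 t, 1 := lintegral_mono fun s => prob_le_one
    _ = ENNReal.ofReal t := by simp

theorem tsum_law_path_le_one (t : ℝ) (η : E) :
    ∑' ζ, R.law η {ω | R.path t ω = some ζ} ≤ 1 := by
  rw [← measure_iUnion _ fun ζ => R.measurableSet_path t ζ]
  · exact prob_le_one
  · intro ζ ζ' hne
    refine Set.disjoint_left.mpr fun ω h h' => hne ?_
    exact Option.some_injective _ (Eq.trans (Eq.symm h) h')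

variable {R} {μ : Measure E}

theorem IsInvariant.tsum_occupation (hμ : R.IsInvariant μ) (t : ℝ) (ζ : E) :
    ∑' η, μ {η} * R.occupation t η ζ = ENNReal.ofReal t * μ {ζ} := by
  unfold occupation
  simp_rw [← lintegral_const_mul _ (R.measurable_law_path _ ζ)]
  rw [← lintegral_tsum fun η => ((R.measurable_law_path η ζ).const_mul _).aemeasurable,
    setLIntegral_congr_fun measurableSet_Ioc (fun s hs => hμ s (le_of_lt hs.1) ζ)]
  simp [mul_comm]

variable (R μ) in
/-- The measure `M(η) = λ(η) μ(η)`. -/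
def chainWeight (η : E) : ℝ≥0∞ := ENNReal.ofReal (R.holdingRate η) * μ {η}

/-- If `μ` is invariant for the process, `M` is invariant for the jump chain. -/
theorem IsInvariant.tsum_chainWeight [IsFiniteMeasure μ] (hμ : R.IsInvariant μ) (ξ : E) :
    ∑' ζ, R.chainWeight μ ζ * R.jumpKernel ζ {ξ} = R.chainWeight μ ξ := by
  classical
  have h : ∑' η, μ {η} * ((if η = ξ then 1 else 0) + ∑' ζ, ENNReal.ofReal (R.holdingRate ζ)
        * R.occupation 1 η ζ * R.jumpKernel ζ {ξ})
      = ∑' η, μ {η} * (R.law η {ω | R.path 1 ω = some ξ}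
        + ENNReal.ofReal (R.holdingRate ξ) * R.occupation 1 η ξ) :=
    tsum_congr fun η => by rw [R.forward_equation η ξ zero_le_one]
  simp_rw [mul_add, ENNReal.tsum_add, hμ 1 zero_le_one ξ, ← ENNReal.tsum_mul_left] at h
  rw [ENNReal.tsum_comm] at h
  have h1 : ∑' η, μ {η} * (if η = ξ then 1 else 0) = μ {ξ} := by
    simp_rw [mul_ite, mul_one, mul_zero]
    rw [tsum_ite_eq]
  have h2 (ζ : E) : ∑' η, μ {η} * (ENNReal.ofReal (R.holdingRate ζ) * R.occupation 1 η ζ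
      * R.jumpKernel ζ {ξ}) = R.chainWeight μ ζ * R.jumpKernel ζ {ξ} := by
    rw [chainWeight, ← one_mul (μ {ζ}), ← ENNReal.ofReal_one, ← hμ.tsum_occupation 1 ζ,
      ← ENNReal.tsum_mul_left, ← ENNReal.tsum_mul_right]
    exact tsum_congr fun η => by ring
  have h3 : ∑' η, μ {η} * (ENNReal.ofReal (R.holdingRate ξ) * R.occupation 1 η ξ)
      = R.chainWeight μ ξ := by
    rw [chainWeight, ← one_mul (μ {ξ}), ← ENNReal.ofReal_one, ← hμ.tsum_occupation 1 ξ,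
      ← ENNReal.tsum_mul_left]
    exact tsum_congr fun η => by ring
  rw [h1, h3] at h
  simp_rw [h2] at h
  exact (ENNReal.add_right_inj (measure_ne_top μ _)).mp h

theorem IsInvariant.tsum_chainWeight_chainLaw [IsFiniteMeasure μ] (hμ : R.IsInvariant μ) (ξ : E)
    (n : ℕ) : ∑' η, R.chainWeight μ η * R.chainLaw η {y | y n = ξ} = R.chainWeight μ ξ := by
  classical
  induction n generalizing ξ with
  | zero =>
    simp_rw [R.chainLaw_zero_apply, mul_ite, mul_one, mul_zero]
    rw [tsum_ite_eq]
  | succ n ih =>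
    simp_rw [chainLaw_succ, ← ENNReal.tsum_mul_left]
    rw [ENNReal.tsum_comm]
    simp_rw [← mul_assoc, ENNReal.tsum_mul_right, ih]
    exact hμ.tsum_chainWeight ξ

theorem IsInvariant.measure_singleton_ne_zero [IsProbabilityMeasure μ] (hμ : R.IsInvariant μ)
    (hirr : R.IsIrreducible) (ξ : E) : μ {ξ} ≠ 0 := by
  intro hξ
  obtain ⟨η, hη⟩ : ∃ η, μ {η} ≠ 0 := by
    by_contra! h
    have h1 : μ Set.univ = 0 := by
      rw [← Set.iUnion_of_singleton]
      exact measure_iUnion_null h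
    simp at h1
  obtain ⟨n, hn⟩ := hirr η ξ
  have h := hμ.tsum_chainWeight_chainLaw ξ n
  rw [chainWeight, hξ, mul_zero, ENNReal.tsum_eq_zero] at h
  have h2 := h η
  simp only [chainWeight, mul_eq_zero, ENNReal.ofReal_eq_zero, hη, hn.ne', or_false] at h2
  exact absurd h2 (not_le.mpr (R.holdingRate_pos η))

theorem tsum_chainWeight_ne_top (hM : Integrable R.holdingRate μ) :
    ∑' η, R.chainWeight μ η ≠ ∞ := by
  have h := hM.lintegral_lt_top
  rw [lintegral_countable'] at h
  exact h.ne

/-- Started from `η`, the process spends at `ζ` no more time than `μ(η)⁻¹` times what it does in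
equilibrium. -/
theorem IsInvariant.mul_occupation_le (hμ : R.IsInvariant μ) (t : ℝ) (η ζ : E) :
    μ {η} * R.occupation t η ζ ≤ ENNReal.ofReal t * μ {ζ} := by
  rw [← hμ.tsum_occupation]
  exact ENNReal.le_tsum (f := fun η => μ {η} * R.occupation t η ζ) η

theorem IsInvariant.tsum_holdingRate_occupation_ne_top [IsProbabilityMeasure μ]
    (hμ : R.IsInvariant μ) (hirr : R.IsIrreducible) (hM : Integrable R.holdingRate μ) (t : ℝ)
    (η : E) : ∑' ζ, ENNReal.ofReal (R.holdingRate ζ) * R.occupation t η ζ ≠ ∞ := by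
  have h : μ {η} * ∑' ζ, ENNReal.ofReal (R.holdingRate ζ) * R.occupation t η ζ
      ≤ ENNReal.ofReal t * ∑' ζ, R.chainWeight μ ζ := by
    rw [← ENNReal.tsum_mul_left, ← ENNReal.tsum_mul_left]
    refine ENNReal.tsum_le_tsum fun ζ => ?_
    calc _ = ENNReal.ofReal (R.holdingRate ζ) * (μ {η} * R.occupation t η ζ) := by ring
      _ ≤ ENNReal.ofReal (R.holdingRate ζ) * (ENNReal.ofReal t * μ {ζ}) :=
        mul_le_mul_right (hμ.mul_occupation_le t η ζ) _
      _ = _ := by rw [chainWeight]; ring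
  intro htop
  rw [htop, ENNReal.mul_top (hμ.measure_singleton_ne_zero hirr η), top_le_iff] at h
  exact ENNReal.mul_ne_top ENNReal.ofReal_ne_top (tsum_chainWeight_ne_top hM) h

end Invariant

/-! ### The equilibrium potential and the capacity -/

section Potential

variable {E : Type*} (R : RateMatrix E) [MeasurableSpace E] [DiscreteMeasurableSpace E]

/-- `q` is a `[0, 1]`-valued function that vanishes at `a`, equals `1` at `b` and is harmonic for
the jump chain elsewhere, such as the probability to reach `b` before `a`. -/
structure IsPotential (a b : E) (q : E → ℝ≥0∞) : Prop where
  le_one : ∀ η, q η ≤ 1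
  eq_zero : q a = 0
  eq_one : q b = 1
  harmonic : ∀ η, η ≠ a → η ≠ b → ∫⁻ ζ, q ζ ∂(R.jumpKernel η) = q η

theorem exists_isPotential {a b : E} (hab : a ≠ b) : ∃ q, R.IsPotential a b q := by
  classical
  let T : (E → ℝ≥0∞) →o (E → ℝ≥0∞) :=
    { toFun f η := if η = a then 0 else if η = b then 1 else ∫⁻ ζ, f ζ ∂(R.jumpKernel η)
      monotone' f f' h η := by
        dsimp only
        split_ifs
        · exact le_rfl
        · exact le_rfl
        · exact lintegral_mono h }
  have hT (η : E) : T T.lfp η = T.lfp η := congrFun T.map_lfp η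
  have hle : T.lfp ≤ fun _ => 1 := by
    refine T.lfp_le fun η => ?_
    change (if η = a then 0 else if η = b then 1 else ∫⁻ _, 1 ∂(R.jumpKernel η)) ≤ (1 : ℝ≥0∞)
    split_ifs <;> simp
  refine ⟨T.lfp, hle, ?_, ?_, fun η ha hb => ?_⟩
  · rw [← hT]; exact if_pos rfl
  · rw [← hT]; exact (if_neg hab.symm).trans (if_pos rfl)
  · conv_rhs => rw [← hT]
    exact ((if_neg ha).trans (if_neg hb)).symm

namespace IsPotential

variable {R} {a b : E} {q : E → ℝ≥0∞}

theorem lintegral_le_one (hq : R.IsPotential a b q) (η : E) :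
    ∫⁻ ζ, q ζ ∂(R.jumpKernel η) ≤ 1 := by
  calc _ ≤ ∫⁻ _, 1 ∂(R.jumpKernel η) := lintegral_mono hq.le_one
    _ = 1 := by simp

variable [Countable E]

/-- Summing a potential against weights of finite mass `w`, and against their image under the jump
chain, the two sums differ in the terms at `a` and `b` only. -/
theorem exists_remainder (hq : R.IsPotential a b q) (hab : a ≠ b) {w : E → ℝ≥0∞}
    (hw : ∑' η, w η ≠ ∞) :
    ∃ r, r ≠ ∞ ∧ ∑' η, w η * q η = w b + r ∧
      ∑' ξ, q ξ * ∑' η, w η * R.jumpKernel η {ξ}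
        = w a * ∫⁻ ζ, q ζ ∂(R.jumpKernel a) + w b * ∫⁻ ζ, q ζ ∂(R.jumpKernel b) + r := by
  classical
  refine ⟨∑' η, if η = a ∨ η = b then 0 else w η * q η, ?_, ?_, ?_⟩
  · refine ne_top_of_le_ne_top hw (ENNReal.tsum_le_tsum fun η => ?_)
    split_ifs
    · exact zero_le
    · exact mul_le_of_le_one_right' (hq.le_one η)
  · have : w b = ∑' η, if η = b then w b else 0 := (tsum_ite_eq b fun _ => w b).symm
    rw [this, ← ENNReal.tsum_add]
    refine tsum_congr fun η => ?_
    by_cases ha : η = a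
    · simp [ha, hq.eq_zero, hab]
    · by_cases hb : η = b
      · simp [hb, hq.eq_one]
      · simp [ha, hb]
  · have hL : ∑' ξ, q ξ * ∑' η, w η * R.jumpKernel η {ξ}
        = ∑' η, w η * ∫⁻ ζ, q ζ ∂(R.jumpKernel η) := by
      simp_rw [← ENNReal.tsum_mul_left]
      rw [ENNReal.tsum_comm]
      refine tsum_congr fun η => ?_
      rw [lintegral_countable', ← ENNReal.tsum_mul_left]
      exact tsum_congr fun ξ => by ring
    have h1 (c : E) : w c * ∫⁻ ζ, q ζ ∂(R.jumpKernel c)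
        = ∑' η, if η = c then w c * ∫⁻ ζ, q ζ ∂(R.jumpKernel c) else 0 :=
      (tsum_ite_eq c fun _ => w c * ∫⁻ ζ, q ζ ∂(R.jumpKernel c)).symm
    rw [hL, h1 a, h1 b, ← ENNReal.tsum_add, ← ENNReal.tsum_add]
    refine tsum_congr fun η => ?_
    by_cases ha : η = a
    · simp [ha, hab]
    · by_cases hb : η = b
      · simp [hb, hab.symm]
      · simp [ha, hb, hq.harmonic η ha hb]

/-- The one step mean of a potential at `a` dominates (in fact equals, for the minimal potential)
the probability that the chain started from `a` reaches `b` before it returns to `a`. The event is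
split according to the time `m + 1` of the first visit to `b`. -/
theorem tsum_chainLaw_le (hq : R.IsPotential a b q) :
    ∑' m, R.chainLaw a {y | y (m + 1) = b ∧ ∀ k, 1 ≤ k → k ≤ m → y k ≠ a ∧ y k ≠ b}
      ≤ ∫⁻ ζ, q ζ ∂(R.jumpKernel a) := by
  classical
  let D (n : ℕ) : Set (ℕ → E) := {y | ∀ k, 1 ≤ k → k ≤ n → y k ≠ a ∧ y k ≠ b}
  let F (n : ℕ) : (ℕ → E) → ℝ≥0∞ := (D n).indicator 1
  let Q (η : E) : ℝ≥0∞ := ∫⁻ ζ, q ζ ∂(R.jumpKernel η)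
  have hne (k : ℕ) (c : E) : MeasurableSet {y : ℕ → E | y k ≠ c} :=
    (measurableSet_eq_fun (measurable_pi_apply k) measurable_const).compl
  have hD (n : ℕ) : MeasurableSet (D n) := by
    simp only [D, Set.ofPred_forall]
    exact .iInter fun k => .iInter fun _ => .iInter fun _ => (hne k a).inter (hne k b)
  have hF (n : ℕ) : Measurable (F n) := measurable_one.indicator (hD n)
  have hdep (n : ℕ) : DependsOn (F n) (Set.Iic n) := by
    intro y y' h
    have : y ∈ D n ↔ y' ∈ D n := by
      refine forall_congr' fun k => forall_congr' fun _ => forall_congr' fun hk => ?_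
      rw [h k hk]
    simp [F, Set.indicator_apply, this]
  have hQm : Measurable Q := .of_discrete
  have hstep (n : ℕ) : ∫⁻ y, F n y * Q (y n) ∂(R.chainLaw a)
      = R.chainLaw a {y | y (n + 1) = b ∧ y ∈ D n}
        + ∫⁻ y, F (n + 1) y * Q (y (n + 1)) ∂(R.chainLaw a) := by
    have hm : MeasurableSet {y : ℕ → E | y (n + 1) = b ∧ y ∈ D n} :=
      (measurableSet_eq_fun (measurable_pi_apply (n + 1)) measurable_const).inter (hD n)
    rw [← R.lintegral_chainLaw_mul_succ a n (hF n) (hdep n) q, ← lintegral_indicator_one hm,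
      ← lintegral_add_left (measurable_one.indicator hm)]
    refine lintegral_congr fun y => ?_
    have hsucc : y ∈ D (n + 1) ↔ y ∈ D n ∧ y (n + 1) ≠ a ∧ y (n + 1) ≠ b := by
      constructor
      · exact fun h => ⟨fun k h1 h2 => h k h1 (h2.trans n.le_succ), h _ (by omega) le_rfl⟩
      · rintro ⟨h, h'⟩ k h1 h2
        rcases h2.lt_or_eq with h2 | rfl
        · exact h k h1 (Nat.lt_succ_iff.mp h2)
        · exact h'
    by_cases hyD : y ∈ D n
    · by_cases ha : y (n + 1) = a
      · have hb : a ≠ b := fun h => by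
          have := hq.eq_zero; rw [h, hq.eq_one] at this; exact one_ne_zero this
        simp [F, hyD, hsucc, ha, hq.eq_zero, hb]
      · by_cases hb : y (n + 1) = b
        · simp [F, hyD, hsucc, hb, hq.eq_one]
        · simp [F, hyD, hsucc, ha, hb, Q, hq.harmonic _ ha hb]
    · simp [F, hyD, hsucc]
  have hsum (n : ℕ) : ∑ m ∈ Finset.range n, R.chainLaw a {y | y (m + 1) = b ∧ y ∈ D m}
      + ∫⁻ y, F n y * Q (y n) ∂(R.chainLaw a) = Q a := by
    induction n with
    | zero =>
      have h0 : ∀ᵐ y ∂(R.chainLaw a), F 0 y * Q (y 0) = Q a := by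
        filter_upwards [R.chainLaw_zero a] with y hy
        have : y ∈ D 0 := fun k h1 h2 => by omega
        simp [F, this, hy]
      simp [lintegral_congr_ae h0]
    | succ n ih => rw [Finset.sum_range_succ, add_assoc, ← hstep n, ih]
  refine ENNReal.tsum_le_of_sum_range_le fun n => ?_
  rw [← show _ = ∫⁻ ζ, q ζ ∂(R.jumpKernel a) from hsum n]
  exact le_self_add

end IsPotential

variable {R} [Countable E] {a b : E}

theorem IsPotential.law_returnTime_le {q : E → ℝ≥0∞} (hq : R.IsPotential a b q) (hab : a ≠ b) :
    R.law a {ω | R.returnTime {b} ω < R.returnTime {a} ω}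
      ≤ ∫⁻ ζ, q ζ ∂(R.jumpKernel a) := by
  let D (m : ℕ) : Set (ℕ → E) := {y | y (m + 1) = b ∧ ∀ k, 1 ≤ k → k ≤ m → y k ≠ a ∧ y k ≠ b}
  have hchain : R.chainLaw a (⋃ m, D m) ≤ ∫⁻ ζ, q ζ ∂(R.jumpKernel a) :=
    (measure_iUnion_le D).trans hq.tsum_chainLaw_le
  refine le_trans ?_ hchain
  rw [← R.law_fst_preimage]
  refine measure_mono_ae ?_
  filter_upwards [R.law_pos a, R.law_chain_ae (R.chainLaw_zero a),
    R.law_chain_ae (R.chainLaw_one_ne a)] with ω hpos h0 h1 hlt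
  -- a time `t` before the return to `a` at which the trajectory visits `b`
  change R.returnTime {b} ω < R.returnTime {a} ω at hlt
  obtain ⟨t, ⟨ht, ⟨ζ, hζ, htb⟩, -⟩, hta⟩ : ∃ t : ℝ, (0 < t ∧
      (∃ ζ ∈ ({b} : Set E), R.path t ω = some ζ) ∧ ∃ s, 0 < s ∧ s < t ∧ R.path s ω ≠ R.path 0 ω) ∧
        ENNReal.ofReal t < R.returnTime {a} ω := by
    simpa only [returnTime, iInf_lt_iff, exists_prop] using hlt
  rw [Set.mem_singleton_iff.mp hζ] at htb
  obtain ⟨n, hnb, hnt, -⟩ := (R.path_eq_some_iff ht.le hpos _).mp htb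
  have hn : n ≠ 0 := by
    rintro rfl
    exact hab (h0.symm.trans hnb)
  classical
  have hex : ∃ m, ω.1 (m + 1) = b := ⟨n - 1, by rw [Nat.sub_add_cancel (by omega)]; exact hnb⟩
  have hmn : Nat.find hex ≤ n - 1 :=
    Nat.find_min' hex (by rw [Nat.sub_add_cancel (by omega)]; exact hnb)
  refine Set.mem_iUnion.mpr ⟨Nat.find hex, Nat.find_spec hex, fun k hk1 hk => ⟨fun hka => ?_, ?_⟩⟩
  · have hk2 : 2 ≤ k := by
      rcases hk1.eq_or_lt with rfl | h
      · exact absurd (hka.trans h0.symm) h1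
      · exact h
    have hle := R.returnTime_le_jumpTime hpos h1 hk2
    rw [hka] at hle
    refine absurd (hta.trans_le (hle.trans (ENNReal.ofReal_le_ofReal ?_))) (lt_irrefl _)
    exact ((R.jumpTime_strictMono hpos).monotone (by omega : k ≤ n)).trans hnt
  · have := Nat.find_min hex (m := k - 1) (by omega)
    rwa [Nat.sub_add_cancel hk1] at this

theorem IsPotential.capacity_le {q : E → ℝ≥0∞} (hq : R.IsPotential a b q) (hab : a ≠ b)
    (μ : Measure E) :
    R.capacity μ {a} {b} ≤ R.chainWeight μ a * ∫⁻ ζ, q ζ ∂(R.jumpKernel a) := by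
  unfold capacity
  rw [tsum_singleton a (fun η => ENNReal.ofReal (R.holdingRate η) * μ {η} *
    R.law η {ω | R.returnTime {b} ω < R.returnTime {a} ω})]
  exact mul_le_mul_right (hq.law_returnTime_le hab) _

variable {μ : Measure E}

/-- The key estimate: until time `t`, the mean times spent at two states, relative to their weights
in equilibrium, differ by at most the inverse of the capacity between the states. -/
theorem IsInvariant.abs_occupation_sub_mul_capacity_le [IsProbabilityMeasure μ]
    (hμ : R.IsInvariant μ) (hirr : R.IsIrreducible) (hM : Integrable R.holdingRate μ) {t : ℝ}
    (ht : 0 ≤ t) (η : E) (hab : a ≠ b) :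
    ENNReal.ofReal |(R.occupation t η a).toReal / μ.real {a}
        - (R.occupation t η b).toReal / μ.real {b}| * R.capacity μ {a} {b} ≤ 1 := by
  obtain ⟨q, hq⟩ := R.exists_isPotential hab
  set x := ∫⁻ ζ, q ζ ∂(R.jumpKernel a)
  set y := ∫⁻ ζ, q ζ ∂(R.jumpKernel b)
  set Λ : E → ℝ≥0∞ := fun ζ => ENNReal.ofReal (R.holdingRate ζ) * R.occupation t η ζ
  have hx : x ≠ ∞ := ne_top_of_le_ne_top ENNReal.one_ne_top (hq.lintegral_le_one a)
  have hy : y ≠ ∞ := ne_top_of_le_ne_top ENNReal.one_ne_top (hq.lintegral_le_one b)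
  have hocc (ζ : E) : R.occupation t η ζ ≠ ∞ :=
    ne_top_of_le_ne_top ENNReal.ofReal_ne_top (R.occupation_le t η ζ)
  have hΛtop (ζ : E) : Λ ζ ≠ ∞ := ENNReal.mul_ne_top ENNReal.ofReal_ne_top (hocc ζ)
  have hWtop (ζ : E) : R.chainWeight μ ζ ≠ ∞ :=
    ENNReal.mul_ne_top ENNReal.ofReal_ne_top (measure_ne_top _ _)
  -- the flux out of `a` equals the flux into `b`, as `M` is invariant
  have hflux : R.chainWeight μ a * x + R.chainWeight μ b * y = R.chainWeight μ b := by
    obtain ⟨r, hr, h1, h2⟩ := hq.exists_remainder hab (tsum_chainWeight_ne_top hM)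
    simp_rw [hμ.tsum_chainWeight, mul_comm (q _), h1] at h2
    exact ((ENNReal.add_left_inj hr).mp h2).symm
  -- the forward equation integrated against the potential
  set u := ∑' ξ, q ξ * R.law η {ω | R.path t ω = some ξ}
  have hu : u ≤ 1 := le_trans
    (ENNReal.tsum_le_tsum fun ξ => mul_le_of_le_one_left' (hq.le_one ξ))
    (R.tsum_law_path_le_one t η)
  have hdynkin : q η + (Λ a * x + Λ b * y) = u + Λ b := by
    classical
    obtain ⟨r, hr, h1, h2⟩ := hq.exists_remainder hab
      (hμ.tsum_holdingRate_occupation_ne_top hirr hM t η)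
    have h : ∑' ξ, q ξ * ((if η = ξ then 1 else 0)
        + ∑' ζ, ENNReal.ofReal (R.holdingRate ζ) * R.occupation t η ζ * R.jumpKernel ζ {ξ})
        = ∑' ξ, q ξ * (R.law η {ω | R.path t ω = some ξ} + Λ ξ) :=
      tsum_congr fun ξ => by rw [R.forward_equation η ξ ht]
    simp_rw [mul_add, ENNReal.tsum_add] at h
    have h3 : ∑' ξ, q ξ * (if η = ξ then 1 else 0) = q η := by
      simp_rw [mul_ite, mul_one, mul_zero, eq_comm (a := η)]
      rw [tsum_ite_eq]
    simp_rw [mul_comm (q _) (Λ _)] at h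
    rw [h2, h3, h1] at h
    refine (ENNReal.add_left_inj hr).mp ?_
    rw [add_assoc (q η), add_assoc u]
    exact h
  refine le_trans (mul_le_mul_right (hq.capacity_le hab μ) _) ?_
  have hμpos (ζ : E) : 0 < μ.real {ζ} :=
    ENNReal.toReal_pos (hμ.measure_singleton_ne_zero hirr ζ) (measure_ne_top _ _)
  have hWr (ζ : E) : (R.chainWeight μ ζ).toReal = R.holdingRate ζ * μ.real {ζ} := by
    rw [chainWeight, ENNReal.toReal_mul, ENNReal.toReal_ofReal (R.holdingRate_pos ζ).le]; rfl
  have hΛr (ζ : E) : (Λ ζ).toReal = R.holdingRate ζ * (R.occupation t η ζ).toReal := by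
    simp only [Λ]
    rw [ENNReal.toReal_mul, ENNReal.toReal_ofReal (R.holdingRate_pos ζ).le]
  have hflux' := congrArg ENNReal.toReal hflux
  have hdynkin' := congrArg ENNReal.toReal hdynkin
  rw [ENNReal.toReal_add (ENNReal.mul_ne_top (hWtop a) hx) (ENNReal.mul_ne_top (hWtop b) hy),
    ENNReal.toReal_mul, ENNReal.toReal_mul, hWr, hWr] at hflux'
  have hut : u ≠ ∞ := ne_top_of_le_ne_top ENNReal.one_ne_top hu
  have hqt : q η ≠ ∞ := ne_top_of_le_ne_top ENNReal.one_ne_top (hq.le_one η)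
  rw [ENNReal.toReal_add hqt (ENNReal.add_ne_top.mpr
      ⟨ENNReal.mul_ne_top (hΛtop a) hx, ENNReal.mul_ne_top (hΛtop b) hy⟩),
    ENNReal.toReal_add (ENNReal.mul_ne_top (hΛtop a) hx) (ENNReal.mul_ne_top (hΛtop b) hy),
    ENNReal.toReal_add hut (hΛtop b), ENNReal.toReal_mul (a := Λ a),
    ENNReal.toReal_mul (a := Λ b), hΛr, hΛr] at hdynkin'
  have hu1 : u.toReal ≤ 1 := ENNReal.toReal_le_of_le_ofReal zero_le_one (by simpa using hu)
  have hq1 : (q η).toReal ≤ 1 :=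
    ENNReal.toReal_le_of_le_ofReal zero_le_one (by simpa using hq.le_one η)
  have hu0 : 0 ≤ u.toReal := ENNReal.toReal_nonneg
  have hq0 : 0 ≤ (q η).toReal := ENNReal.toReal_nonneg
  rw [← ENNReal.ofReal_toReal (ENNReal.mul_ne_top (hWtop a) hx),
    ← ENNReal.ofReal_mul (abs_nonneg _), ENNReal.ofReal_le_one, ENNReal.toReal_mul, hWr]
  have hnn : 0 ≤ R.holdingRate a * μ.real {a} * x.toReal :=
    mul_nonneg (mul_nonneg (R.holdingRate_pos a).le (hμpos a).le) ENNReal.toReal_nonneg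
  rw [← abs_of_nonneg hnn, ← abs_mul]
  have hkey : ((R.occupation t η a).toReal / μ.real {a}
      - (R.occupation t η b).toReal / μ.real {b}) * (R.holdingRate a * μ.real {a} * x.toReal)
      = u.toReal - (q η).toReal := by
    have h1 : R.holdingRate a * μ.real {a} * x.toReal
        = R.holdingRate b * μ.real {b} * (1 - y.toReal) := by linarith
    rw [sub_mul]
    nth_rewrite 2 [h1]
    have e1 : (R.occupation t η a).toReal / μ.real {a} * (R.holdingRate a * μ.real {a} * x.toReal)
        = R.holdingRate a * (R.occupation t η a).toReal * x.toReal := by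
      have := (hμpos a).ne'
      field_simp
    have e2 : (R.occupation t η b).toReal / μ.real {b}
        * (R.holdingRate b * μ.real {b} * (1 - y.toReal))
        = R.holdingRate b * (R.occupation t η b).toReal * (1 - y.toReal) := by
      have := (hμpos b).ne'
      field_simp
    rw [e1, e2]
    linarith
  rw [hkey, abs_le]
  constructor <;> linarith

end Potential

/-! ### Additive functionals -/

section Additive

variable {E : Type*} (R : RateMatrix E) [MeasurableSpace E] [DiscreteMeasurableSpace E]
  [Countable E]

theorem prod_path_eq_occupation (t : ℝ) (η ζ : E) :
    ((R.law η).prod (volume.restrict (Set.Ioc 0 t))) {z | R.path z.2 z.1 = some ζ}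
      = R.occupation t η ζ := by
  rw [Measure.prod_apply_symm (R.measurableSet_path_prod ζ)]
  rfl

theorem measurable_evalPath (g : E → ℝ) :
    Measurable fun z : Sample E × ℝ => R.evalPath g z.2 z.1 := by
  intro T hT
  have h : (fun z : Sample E × ℝ => R.evalPath g z.2 z.1) ⁻¹' T
      = {z | (∃ ζ, R.path z.2 z.1 = some ζ ∧ g ζ ∈ T)
        ∨ (∀ ζ, ¬ R.path z.2 z.1 = some ζ) ∧ (0 : ℝ) ∈ T} := by
    ext z
    cases hz : R.path z.2 z.1 <;> simp [evalPath, hz]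
  have hB (ζ : E) := measurableSet_setOfPred.mp (R.measurableSet_path_prod ζ)
  rw [h]
  exact measurableSet_setOfPred.mpr (.or (.exists fun ζ => (hB ζ).and measurable_const)
    ((Measurable.forall fun ζ => (hB ζ).not).and measurable_const))

variable {R} {μ : Measure E}

/-- The additive functional of an integrable function is integrable, and its mean is the integral of
the function against the occupation times. -/
theorem IsInvariant.integrable_evalPath [IsProbabilityMeasure μ] (hμ : R.IsInvariant μ)
    (hirr : R.IsIrreducible) {g : E → ℝ} (hg : Integrable g μ) (t : ℝ) (η : E) :
    Integrable (fun z : Sample E × ℝ => R.evalPath g z.2 z.1)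
        ((R.law η).prod (volume.restrict (Set.Ioc 0 t))) ∧
      ∫ z, R.evalPath g z.2 z.1 ∂((R.law η).prod (volume.restrict (Set.Ioc 0 t)))
        = ∑' ζ, (R.occupation t η ζ).toReal * g ζ := by
  set m := (R.law η).prod (volume.restrict (Set.Ioc 0 t))
  let B (ζ : E) : Set (Sample E × ℝ) := {z | R.path z.2 z.1 = some ζ}
  have hB (ζ : E) : MeasurableSet (B ζ) := R.measurableSet_path_prod ζ
  have hmB (ζ : E) : m (B ζ) = R.occupation t η ζ := R.prod_path_eq_occupation t η ζ
  have hdisj : Pairwise (Function.onFun Disjoint B) := by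
    intro ζ ζ' hne
    refine Set.disjoint_left.mpr fun z h h' => hne ?_
    exact Option.some_injective _ (Eq.trans (Eq.symm h) h')
  have hval (ζ : E) {z : Sample E × ℝ} (hz : z ∈ B ζ) : R.evalPath g z.2 z.1 = g ζ := by
    have hz' : R.path z.2 z.1 = some ζ := hz
    simp [evalPath, hz']
  have hsupp : Function.support (fun z : Sample E × ℝ => R.evalPath g z.2 z.1) ⊆ ⋃ ζ, B ζ := by
    intro z hz
    cases h : R.path z.2 z.1 with
    | none => simp [evalPath, h] at hz
    | some ξ => exact Set.mem_iUnion.mpr ⟨ξ, h⟩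
  have hfin : ∑' ζ, ‖g ζ‖ₑ * R.occupation t η ζ ≠ ∞ := by
    have h : μ {η} * ∑' ζ, ‖g ζ‖ₑ * R.occupation t η ζ
        ≤ ENNReal.ofReal t * ∫⁻ ζ, ‖g ζ‖ₑ ∂μ := by
      rw [lintegral_countable', ← ENNReal.tsum_mul_left, ← ENNReal.tsum_mul_left]
      refine ENNReal.tsum_le_tsum fun ζ => ?_
      calc _ = ‖g ζ‖ₑ * (μ {η} * R.occupation t η ζ) := by ring
        _ ≤ ‖g ζ‖ₑ * (ENNReal.ofReal t * μ {ζ}) :=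
          mul_le_mul_right (hμ.mul_occupation_le t η ζ) _
        _ = _ := by ring
    intro htop
    rw [htop, ENNReal.mul_top (hμ.measure_singleton_ne_zero hirr η), top_le_iff] at h
    exact ENNReal.mul_ne_top ENNReal.ofReal_ne_top hg.2.ne h
  have hint : Integrable (fun z : Sample E × ℝ => R.evalPath g z.2 z.1) m := by
    refine ⟨(R.measurable_evalPath g).aestronglyMeasurable, ?_⟩
    rw [HasFiniteIntegral, ← setLIntegral_eq_of_support_subset (s := ⋃ ζ, B ζ) ?_,
      lintegral_iUnion hB hdisj]
    · refine lt_of_le_of_lt (le_of_eq ?_) hfin.lt_top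
      refine tsum_congr fun ζ => ?_
      rw [setLIntegral_congr_fun (hB ζ) (fun z hz => by rw [hval ζ hz])]
      simp [hmB]
    · exact fun z hz => hsupp fun h => hz (by simp only [h, enorm_zero])
  refine ⟨hint, ?_⟩
  rw [← setIntegral_eq_integral_of_forall_compl_eq_zero (s := ⋃ ζ, B ζ)
    (fun z hz => by by_contra h; exact hz (hsupp h)), integral_iUnion hB hdisj hint.integrableOn]
  refine tsum_congr fun ζ => ?_
  rw [setIntegral_congr_fun (hB ζ) (fun z hz => hval ζ hz), setIntegral_const]
  simp [Measure.real, hmB]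

end Additive

end

end RateMatrix

/-! ### Conditional expectations given a finite partition -/

section Partition

variable {E S : Type*} [MeasurableSpace E] [Fintype S] {μ : Measure E} {A : S → Set E} {g : E → ℝ}

theorem partitionCondExp_of_mem (hdisj : ∀ x y, x ≠ y → Disjoint (A x) (A y)) {x : S} {ζ : E}
    (hζ : ζ ∈ A x) : partitionCondExp μ A g ζ = (∫ ζ in A x, g ζ ∂μ) / μ.real (A x) := by
  unfold partitionCondExp
  rw [Finset.sum_eq_single x _ (by simp), Set.indicator_of_mem hζ]
  intro y _ hy
  exact Set.indicator_of_notMem (fun h => Set.disjoint_left.mp (hdisj x y hy.symm) hζ h) _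

variable [DiscreteMeasurableSpace E] [IsFiniteMeasure μ]

theorem integrable_partitionCondExp : Integrable (partitionCondExp μ A g) μ := by
  unfold partitionCondExp
  exact integrable_finsetSum _ fun x _ => (integrable_const _).indicator (.of_discrete)

theorem setIntegral_sub_partitionCondExp (hdisj : ∀ x y, x ≠ y → Disjoint (A x) (A y))
    (hg : Integrable g μ) {x : S} (hx : μ (A x) ≠ 0) :
    ∫ ζ in A x, (g ζ - partitionCondExp μ A g ζ) ∂μ = 0 := by
  have hx' : μ.real (A x) ≠ 0 := (ENNReal.toReal_pos hx (measure_ne_top _ _)).ne'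
  rw [setIntegral_congr_fun (.of_discrete) (fun ζ hζ => by
      rw [partitionCondExp_of_mem (g := g) hdisj hζ]),
    integral_sub hg.integrableOn (integrable_const _), setIntegral_const, smul_eq_mul,
    mul_div_cancel₀ _ hx', sub_self]

theorem setLIntegral_sub_partitionCondExp_le (hdisj : ∀ x y, x ≠ y → Disjoint (A x) (A y)) {x : S}
    (hx : μ (A x) ≠ 0) :
    ∫⁻ ζ in A x, ‖g ζ - partitionCondExp μ A g ζ‖ₑ ∂μ ≤ 2 * ∫⁻ ζ in A x, ‖g ζ‖ₑ ∂μ := by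
  have hx' : μ.real (A x) ≠ 0 := (ENNReal.toReal_pos hx (measure_ne_top _ _)).ne'
  set c := (∫ ζ in A x, g ζ ∂μ) / μ.real (A x)
  have hc : ‖c‖ₑ * μ (A x) ≤ ∫⁻ ζ in A x, ‖g ζ‖ₑ ∂μ := by
    have h : ‖c‖ₑ * μ (A x) = ‖∫ ζ in A x, g ζ ∂μ‖ₑ := by
      rw [← div_mul_cancel₀ (∫ ζ in A x, g ζ ∂μ) hx', enorm_mul,
        Real.enorm_of_nonneg measureReal_nonneg, ofReal_measureReal]
    rw [h]
    exact enorm_integral_le_lintegral_enorm _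
  calc ∫⁻ ζ in A x, ‖g ζ - partitionCondExp μ A g ζ‖ₑ ∂μ
      ≤ ∫⁻ ζ in A x, (‖g ζ‖ₑ + ‖c‖ₑ) ∂μ := by
        refine setLIntegral_mono .of_discrete fun ζ hζ => ?_
        rw [partitionCondExp_of_mem hdisj hζ]
        exact enorm_sub_le
    _ = ∫⁻ ζ in A x, ‖g ζ‖ₑ ∂μ + ‖c‖ₑ * μ (A x) := by
        rw [lintegral_add_right _ measurable_const, setLIntegral_const]
    _ ≤ _ := by
        rw [two_mul]
        gcongr

end Partition

namespace RateMatrix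

/-! ### The bound on additive functionals -/

section Bound

variable {E : Type*} {R : RateMatrix E} [MeasurableSpace E] [DiscreteMeasurableSpace E]
  [Countable E] {μ : Measure E} [IsProbabilityMeasure μ]

theorem IsInvariant.enorm_occupation_sub_le_inv_pointCapacity (hμ : R.IsInvariant μ)
    (hirr : R.IsIrreducible) (hM : Integrable R.holdingRate μ) {t : ℝ} (ht : 0 ≤ t) (η : E)
    {A : Set E} {ξ ζ : E} (hζ : ζ ∈ A) :
    ‖(R.occupation t η ζ).toReal / μ.real {ζ} - (R.occupation t η ξ).toReal / μ.real {ξ}‖ₑ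
      ≤ (R.pointCapacity μ A ξ)⁻¹ := by
  by_cases h : ζ = ξ
  · simp [h]
  · rw [ENNReal.le_inv_iff_mul_le, Real.enorm_eq_ofReal_abs]
    exact (mul_le_mul_right (iInf₂_le ζ ⟨hζ, h⟩) _).trans
      (hμ.abs_occupation_sub_mul_capacity_le hirr hM ht η h)

/-- The bound for the mean of an additive functional, written as a sum against the occupation times.
The factor `2` arises because subtracting from `g` its mean over a cell at most doubles the mass of
`|g|` there. -/
theorem IsInvariant.enorm_tsum_occupation_le (hμ : R.IsInvariant μ) (hirr : R.IsIrreducible)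
    (hM : Integrable R.holdingRate μ) {S : Type*} [Fintype S] {A : S → Set E} {ξ : S → E}
    (hdisj : ∀ x y, x ≠ y → Disjoint (A x) (A y)) (hcover : (⋃ x, A x) = Set.univ)
    (hξ : ∀ x, ξ x ∈ A x) {g : E → ℝ} (hg : Integrable g μ) {t : ℝ} (ht : 0 ≤ t) (η : E) :
    ‖∑' ζ, (R.occupation t η ζ).toReal * (g ζ - partitionCondExp μ A g ζ)‖ₑ
      ≤ 2 * ∑ x, (∫⁻ ζ in A x, ‖g ζ‖ₑ ∂μ) / R.pointCapacity μ (A x) (ξ x) := by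
  set h : E → ℝ := fun ζ => g ζ - partitionCondExp μ A g ζ
  let r (ζ : E) : ℝ := (R.occupation t η ζ).toReal / μ.real {ζ}
  have hh : Integrable h μ := hg.sub integrable_partitionCondExp
  have hμpos (ζ : E) : 0 < μ.real {ζ} :=
    ENNReal.toReal_pos (hμ.measure_singleton_ne_zero hirr ζ) (measure_ne_top _ _)
  have hA (x : S) : μ (A x) ≠ 0 := fun h0 => hμ.measure_singleton_ne_zero hirr (ξ x)
    (measure_mono_null (Set.singleton_subset_iff.mpr (hξ x)) h0)
  have hr (ζ : E) : ‖r ζ‖ ≤ t / μ.real {η} := by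
    have h1 := ENNReal.toReal_mono
      (ENNReal.mul_ne_top ENNReal.ofReal_ne_top (measure_ne_top _ _)) (hμ.mul_occupation_le t η ζ)
    rw [ENNReal.toReal_mul, ENNReal.toReal_mul, ENNReal.toReal_ofReal ht] at h1
    rw [Real.norm_of_nonneg (by positivity), div_le_div_iff₀ (hμpos ζ) (hμpos η), mul_comm]
    exact h1
  have hhr : Integrable (fun ζ => h ζ * r ζ) μ :=
    hh.mul_bdd Measurable.of_discrete.aestronglyMeasurable (ae_of_all _ hr)
  have hsum : ∑' ζ, (R.occupation t η ζ).toReal * h ζ = ∑ x, ∫ ζ in A x, h ζ * r ζ ∂μ := by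
    rw [← integral_iUnion_fintype (fun x => .of_discrete) (fun x y hxy => hdisj x y hxy)
      (fun x => hhr.integrableOn), hcover, setIntegral_univ, integral_countable hhr]
    refine tsum_congr fun ζ => ?_
    have := (hμpos ζ).ne'
    simp only [r, smul_eq_mul]
    field_simp
  -- `h` has mean zero on every cell, so a constant may be subtracted from `r` there
  have hcell (x : S) : ∫ ζ in A x, h ζ * r ζ ∂μ = ∫ ζ in A x, h ζ * (r ζ - r (ξ x)) ∂μ := by
    simp_rw [mul_sub]
    rw [integral_sub hhr.integrableOn (hh.integrableOn.mul_const _), integral_mul_const,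
      setIntegral_sub_partitionCondExp hdisj hg (hA x), zero_mul, sub_zero]
  rw [hsum, Finset.mul_sum]
  refine (enorm_sum_le _ _).trans (Finset.sum_le_sum fun x _ => ?_)
  rw [hcell]
  calc ‖∫ ζ in A x, h ζ * (r ζ - r (ξ x)) ∂μ‖ₑ
      ≤ ∫⁻ ζ in A x, ‖h ζ * (r ζ - r (ξ x))‖ₑ ∂μ := enorm_integral_le_lintegral_enorm _
    _ ≤ ∫⁻ ζ in A x, ‖h ζ‖ₑ * (R.pointCapacity μ (A x) (ξ x))⁻¹ ∂μ := by
        refine setLIntegral_mono .of_discrete fun ζ hζ => ?_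
        rw [enorm_mul]
        exact mul_le_mul_right
          (hμ.enorm_occupation_sub_le_inv_pointCapacity hirr hM ht η hζ) _
    _ = (∫⁻ ζ in A x, ‖h ζ‖ₑ ∂μ) * (R.pointCapacity μ (A x) (ξ x))⁻¹ :=
        lintegral_mul_const _ .of_discrete
    _ ≤ (2 * ∫⁻ ζ in A x, ‖g ζ‖ₑ ∂μ) * (R.pointCapacity μ (A x) (ξ x))⁻¹ :=
        mul_le_mul_left (setLIntegral_sub_partitionCondExp_le hdisj (hA x)) _
    _ = _ := by rw [mul_assoc, div_eq_mul_inv]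

end Bound

end RateMatrix

theorem corollarys09 {E : Type*} [Countable E] [MeasurableSpace E] [DiscreteMeasurableSpace E]
    (R : RateMatrix E) (hirr : R.IsIrreducible) (hrec : R.IsRecurrent)
    (hpos : R.IsPositiveRecurrent)
    (μ : Measure E) [IsProbabilityMeasure μ] (hμ : R.IsInvariant μ)
    (hM : Integrable R.holdingRate μ)
    {S : Type*} [Fintype S] (A : S → Set E) (ξ : S → E)
    (hdisj : ∀ x y, x ≠ y → Disjoint (A x) (A y)) (hcover : (⋃ x, A x) = Set.univ)
    (hξ : ∀ x, ξ x ∈ A x)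
    (g : E → ℝ) (hg : Integrable g μ) (t : ℝ) (ht : 0 < t) :
    (∀ η, Integrable
      (fun z : RateMatrix.Sample E × ℝ =>
        R.evalPath (fun ζ => g ζ - partitionCondExp μ A g ζ) z.2 z.1)
      ((R.law η).prod (volume.restrict (Set.Ioc 0 t)))) ∧
    (⨆ η, ENNReal.ofReal |∫ ω, (∫ s in (0 : ℝ)..t,
        R.evalPath (fun ζ => g ζ - partitionCondExp μ A g ζ) s ω) ∂(R.law η)|)
      ≤ 4 * ∑ x, (∫⁻ ζ in A x, ENNReal.ofReal |g ζ| ∂μ) / R.pointCapacity μ (A x) (ξ x) := by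
  have hint (η : E) := hμ.integrable_evalPath hirr
    (hg.sub (integrable_partitionCondExp (A := A) (g := g))) t η
  refine ⟨fun η => (hint η).1, iSup_le fun η => ?_⟩
  obtain ⟨h1, h2⟩ := hint η
  simp_rw [intervalIntegral.integral_of_le ht.le, ← Real.enorm_eq_ofReal_abs]
  rw [integral_prod _ h1] at h2
  refine (congrArg _ h2).trans_le ?_
  refine (hμ.enorm_tsum_occupation_le hirr hM hdisj hcover hξ hg ht.le η).trans ?_
  gcongr
  norm_num
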